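/- Setting. Let $Q=[-1,1]^2$ and let $\varphi_k$, $k\ge 0$, be the orthonormal Legendre polynomials on $[-1,1]$. For $f\in L_2(Q)$ put $\langle f,\varphi_{k,j}\rangle=\int_Q f(t,\tau)\varphi_k(t)\varphi_j(\tau)\,dt\,d\tau$. With $\underline{k}=\max\{1,k\}$, let $L^{\mu}_{s,2}$ be the class of all $f\in L_2(Q)$ with $\|f\|_{s,\mu}^s=\sum_{k,j\ge 0}\underline{k}^{s\mu_1}\underline{j}^{s\mu_2}|\langle f,\varphi_{k,j}\rangle|^s\le 1$, and for $r\in\{1,2,\dots\}$ let $$f^{(0,r)}(t,\tau)=\sum_{k\ge 0}\sum_{j\ge r}\langle f,\varphi_{k,j}\rangle\,\varphi_k(t)\,\varphi_j^{(r)}(\tau).$$ For $1\le p\le\infty$ and $0<\delta<1$, a real sequence $\overline{f}^\delta=(f^\delta_{k,j})_{k,j\ge0}$ is an admissible perturbation of $f$ if $\|(\langle f,\varphi_{k,j}\rangle-f^\delta_{k,j})_{k,j}\|_{\ell_p}\le\delta$. For a finite set $\Omega\subset\{(k,j)\in\mathbb{N}_0^2: j\ge r\}$ and an arbitrary map $\psi:\mathbb{R}^{\Omega}\to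 C(Q)$ let $$\varepsilon_\delta(\psi)=\sup_{f\in L^\mu_{s,2}}\ \sup_{\overline{f}^\delta\text{ admissible}}\big\|f^{(0,r)}-\psi\big((f^\delta_{k,j})_{(k,j)\in\Omega}\big)\big\|_{C(Q)},\qquad R^{(0,r)}_{N,\delta}=\inf_{\operatorname{card}\Omega\le N}\ \inf_{\psi:\mathbb{R}^\Omega\to C(Q)}\varepsilon_\delta(\psi).$$ For $\gamma\ge 1$ and $n\in\mathbb{N}_0$ let $\Gamma_{n,\gamma}=\{(k,j):k^\gamma j\le n,\ 0\le k\le n^{1/\gamma},\ r\le j\le n\}$ and let $\mathcal{D}^{(0,r)}_{n,\gamma}$ be the truncation method $\overline{f}^\delta\mapsto\sum_{(k,j)\in\Gamma_{n,\gamma}}f^\delta_{k,j}\,\varphi_k(t)\,\varphi_j^{(r)}(\tau)$, which uses the information set $\Omega=\Gamma_{n,\gamma}$. Theorem. Let $r\ge 1$ be an integer, $1\le s<\infty$, $1\le p\le\infty$, $\mu_2>2r-\frac1s+\frac32$ and $\mu_1>\mu_2-2r$. Put $\kappa=\mu_2-2r+\frac1s-\frac32$ and $d=\mu_2-\frac1p+\frac1s$.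 For every $f\in L^\mu_{s,2}$ the series defining $f^{(0,r)}$ converges unconditionally in $C(Q)$. Below, $N,n$ are integers; $A\asymp B$ means $C_1B\le A\le C_2B$ and $A\preceq B$ means $A\le C_2B$, where the constants $C_1,C_2>0$ in the conclusions may depend on $r,s,p,\mu_1,\mu_2,\gamma$ and on the constants of the relations $\asymp$ in the assumptions, but not on $\delta,N,n$. Part a) holds for all $0<\delta<1$; part b) holds as $\delta\to0$, i.e. for all $0<\delta\le\delta_0$, where $\delta_0\in(0,1)$ may depend on the same quantities as the constants. a) If $N\asymp\delta^{-1/d}$, then $$R^{(0,r)}_{N,\delta}\asymp N^{-\kappa}\asymp\delta^{\kappa/d}.$$ These order-optimal estimates are attained by $\mathcal{D}^{(0,r)}_{n,\gamma}$ whenever $n\asymp\delta^{-1/d}$ and $1<\gamma<\dfrac{\mu_1+1/s-3/2}{\mu_2-2r+1/s-3/2}$: one has $\varepsilon_\delta(\mathcal{D}^{(0,r)}_{n,\gamma})\asymp N^{-\kappa}\asymp\delta^{\kappa/d}$, while $\operatorname{card}\Gamma_{n,\gamma}\preceq\delta^{-1/d}$, and moreover $\operatorname{card}\Gamma_{n,\gamma}\asymp\delta^{-1/d}$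 if $n\ge r$. b) If $N\asymp\delta^{-1/d}\ln\frac1\delta$, then $$N^{-\kappa}\preceq R^{(0,r)}_{N,\delta}\preceq\Big(\frac{N}{\ln N}\Big)^{-\kappa},\qquad \delta^{\kappa/d}\Big(\ln\frac1\delta\Big)^{-\kappa}\preceq R^{(0,r)}_{N,\delta}\preceq\delta^{\kappa/d}.$$ The upper bounds are attained by $\mathcal{D}^{(0,r)}_{n,1}$ whenever $n\asymp\delta^{-1/d}$: one has $\varepsilon_\delta(\mathcal{D}^{(0,r)}_{n,1})\preceq(N/\ln N)^{-\kappa}$ and $\varepsilon_\delta(\mathcal{D}^{(0,r)}_{n,1})\preceq\delta^{\kappa/d}$, while $\operatorname{card}\Gamma_{n,1}\asymp\delta^{-1/d}\ln\frac1\delta$. -/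

import Mathlib

open MeasureTheory Set
open scoped ENNReal BigOperators

namespace NumDiff

noncomputable section

/-- The square `Q = [-1,1]²`. -/
def square : Set (ℝ × ℝ) := Icc (-1 : ℝ) 1 ×ˢ Icc (-1 : ℝ) 1

instance square_compactSpace : CompactSpace square :=
  isCompact_iff_compactSpace.mp (isCompact_Icc.prod isCompact_Icc)

/-- The `k`-th orthonormal Legendre polynomial on `[-1,1]` (Rodrigues formula):
`φ_k(t) = √(k + 1/2) (2^k k!)⁻¹ (d/dt)^k (t² - 1)^k`. -/
def legendre (k : ℕ) : Polynomial ℝ :=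
  Polynomial.C (Real.sqrt ((k : ℝ) + 1 / 2) * ((2 : ℝ) ^ k * (k.factorial : ℝ))⁻¹) *
    (Polynomial.derivative^[k] ((Polynomial.X ^ 2 - 1) ^ k))

/-- The Fourier-Legendre coefficient `⟨f, φ_{k,j}⟩`, with `q = (k, j)`. -/
def coeff (f : ℝ × ℝ → ℝ) (q : ℕ × ℕ) : ℝ :=
  ∫ x in square, f x * ((legendre q.1).eval x.1 * (legendre q.2).eval x.2)

/-- The term `max(1,k)^{s μ₁} max(1,j)^{s μ₂} |⟨f, φ_{k,j}⟩|^s` of `‖f‖_{s,μ}^s`. -/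
def weightedTerm (s μ₁ μ₂ : ℝ) (f : ℝ × ℝ → ℝ) (q : ℕ × ℕ) : ℝ :=
  ((max 1 q.1 : ℕ) : ℝ) ^ (s * μ₁) * ((max 1 q.2 : ℕ) : ℝ) ^ (s * μ₂) * |coeff f q| ^ s

/-- The class `L^μ_{s,2}`: square-integrable functions on `Q` with `‖f‖_{s,μ} ≤ 1`. -/
def unitClass (s μ₁ μ₂ : ℝ) : Set (ℝ × ℝ → ℝ) :=
  {f | MemLp f 2 (volume.restrict square) ∧ Summable (weightedTerm s μ₁ μ₂ f) ∧
    (∑' q, weightedTerm s μ₁ μ₂ f q) ^ (1 / s) ≤ 1}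

/-- The function `(t, τ) ↦ φ_k(t) φ_j^{(r)}(τ)` as an element of `C(Q)`, with `q = (k, j)`. -/
def derivBasis (r : ℕ) (q : ℕ × ℕ) : C(square, ℝ) where
  toFun x := (legendre q.1).eval x.1.1 * (Polynomial.derivative^[r] (legendre q.2)).eval x.1.2
  continuous_toFun := by fun_prop

/-- The terms of the series defining `f^{(0,r)}`, indexed by the pairs `(k, j)` with `j ≥ r`. -/
def derivTerm (r : ℕ) (f : ℝ × ℝ → ℝ) (q : {q : ℕ × ℕ // r ≤ q.2}) : C(square, ℝ) :=
  coeff f q.1 • derivBasis r q.1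

/-- `f^{(0,r)} = ∑_{k ≥ 0} ∑_{j ≥ r} ⟨f, φ_{k,j}⟩ φ_k(t) φ_j^{(r)}(τ)`, the sum taken in `C(Q)`. -/
def partialDeriv (r : ℕ) (f : ℝ × ℝ → ℝ) : C(square, ℝ) :=
  ∑' q, derivTerm r f q

/-- `y` is a `δ`-perturbation of the sequence `x` in the metric of `ℓ_p`. -/
def IsPerturbation (p : ℝ≥0∞) (δ : ℝ) (x y : ℕ × ℕ → ℝ) : Prop :=
  ∃ ξ : lp (fun _ : ℕ × ℕ => ℝ) p, (∀ q, ξ q = x q - y q) ∧ ‖ξ‖ ≤ δ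

/-- The error `ε_δ(L^μ_{s,2}, ψ(Ω), C, ℓ_p)` of an algorithm `ψ` that uses the perturbed
coefficients with indices in `Ω`. It may be infinite. -/
def algError (r : ℕ) (s μ₁ μ₂ : ℝ) (p : ℝ≥0∞) (δ : ℝ) (Ω : Finset (ℕ × ℕ))
    (ψ : (Ω → ℝ) → C(square, ℝ)) : ℝ≥0∞ :=
  ⨆ f ∈ unitClass s μ₁ μ₂, ⨆ y : ℕ × ℕ → ℝ, ⨆ _ : IsPerturbation p δ (coeff f) y,
    ENNReal.ofReal ‖partialDeriv r f - ψ (fun q => y q.1)‖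

/-- The minimal radius of Galerkin information `R^{(0,r)}_{N,δ}(L^μ_{s,2}, C, ℓ_p)`: the infimum
over all sets `Ω` of at most `N` indices in `[0,∞) × [r,∞)` and over all maps `ψ : ℝ^Ω → C(Q)`. -/
def minRadius (r : ℕ) (s μ₁ μ₂ : ℝ) (p : ℝ≥0∞) (N : ℕ) (δ : ℝ) : ℝ≥0∞ :=
  ⨅ Ω : Finset (ℕ × ℕ), ⨅ _ : (∀ q ∈ Ω, r ≤ q.2) ∧ Ω.card ≤ N,
    ⨅ ψ : (Ω → ℝ) → C(square, ℝ), algError r s μ₁ μ₂ p δ Ω ψ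

open Classical in
/-- The hyperbolic cross
`Γ_{n,γ} = {(k, j) : k^γ j ≤ n, 0 ≤ k ≤ n^{1/γ}, r ≤ j ≤ n}` (for `γ ≥ 1`, where
`n^{1/γ} ≤ n`). -/
def hyperbolicCross (r n : ℕ) (γ : ℝ) : Finset (ℕ × ℕ) :=
  (Finset.range (n + 1) ×ˢ Finset.Icc r n).filter
    (fun q => (q.1 : ℝ) ^ γ * (q.2 : ℝ) ≤ (n : ℝ) ∧ (q.1 : ℝ) ≤ (n : ℝ) ^ (1 / γ))

/-- The truncation method `D^{(0,r)}_{n,γ}` as an algorithm that uses the coefficients with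
indices in `Γ_{n,γ}`. -/
def truncation (r n : ℕ) (γ : ℝ) (y : hyperbolicCross r n γ → ℝ) : C(square, ℝ) :=
  ∑ q : hyperbolicCross r n γ, y q • derivBasis r q.1

/-- The error of the truncation method on the class `L^μ_{s,2}`. -/
def truncError (r : ℕ) (s μ₁ μ₂ : ℝ) (p : ℝ≥0∞) (δ : ℝ) (n : ℕ) (γ : ℝ) : ℝ≥0∞ :=
  algError r s μ₁ μ₂ p δ (hyperbolicCross r n γ) (truncation r n γ)

/-- `c x ≤ y ≤ C x`. -/
def Comparable (c C x y : ℝ) : Prop := c * x ≤ y ∧ y ≤ C * x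

/-- `c x ≤ E ≤ C x` for an extended nonnegative quantity `E`. -/
def ComparableE (c C x : ℝ) (E : ℝ≥0∞) : Prop :=
  ENNReal.ofReal (c * x) ≤ E ∧ E ≤ ENNReal.ofReal (C * x)

end

end NumDiff

namespace NumDiff


open Polynomial in
/-- The differential equation satisfied by the derivatives of `(X² - 1)^k`. -/
theorem iterate_derivative_sq_sub_one_pow_ode (k m : ℕ) :
    (X ^ 2 - 1) * derivative^[m + 2] ((X ^ 2 - 1 : ℝ[X]) ^ k)
      + C (2 * (m + 1 : ℝ) - 2 * k) * X * derivative^[m + 1] ((X ^ 2 - 1 : ℝ[X]) ^ k)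
      + C ((m + 1 : ℝ) * (m - 2 * k)) * derivative^[m] ((X ^ 2 - 1 : ℝ[X]) ^ k) = 0 := by
  induction m with
  | zero =>
    have h : (X ^ 2 - 1) * derivative ((X ^ 2 - 1 : ℝ[X]) ^ k)
        = C (2 * (k : ℝ)) * X * (X ^ 2 - 1) ^ k := by
      rw [derivative_pow]
      rcases k with _ | k
      · simp
      · simp only [derivative_sub, derivative_X_pow, derivative_one, Nat.add_sub_cancel]
        simp
        ring
    have h' := congrArg derivative h
    simp only [derivative_mul, derivative_sub, derivative_X_pow, derivative_one, derivative_C,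
      derivative_X] at h'
    simp only [Function.iterate_succ, Function.iterate_zero, Function.comp_apply, id_eq]
    simp at h' ⊢
    linear_combination h'
  | succ m ih =>
    have h' := congrArg derivative ih
    simp only [derivative_mul, derivative_add, derivative_sub, derivative_X_pow, derivative_one,
      derivative_C, derivative_X, ← Function.iterate_succ_apply' derivative] at h'
    simp [show (C 2 : ℝ[X]) = 2 from rfl] at h' ⊢
    linear_combination h'

open Polynomial in
theorem iterate_derivative_comp_neg_X (p : ℝ[X]) (m : ℕ) :
    (derivative^[m] p).comp (-X) = C ((-1) ^ m) * derivative^[m] (p.comp (-X)) := by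
  induction m with
  | zero => simp
  | succ m ih =>
    have h := congrArg derivative ih
    rw [derivative_comp, derivative_C_mul] at h
    simp only [← Function.iterate_succ_apply' derivative] at h
    simp [pow_succ] at h ⊢
    linear_combination -h

open Polynomial in
/-- A polynomial solution of `(1 - x²) y'' = 2 a x y' - L y` with `a ≥ 1/2`, `L > 0` is bounded on
`[0, 1]` by its value at `1`. -/
theorem abs_eval_le_abs_eval_one_of_ode (y : ℝ[X]) {a L : ℝ} (ha : 1 / 2 ≤ a) (hL : 0 < L)
    (hy : (X ^ 2 - 1) * derivative (derivative y) + C (2 * a) * X * derivative y - C L * y = 0)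
    {x : ℝ} (hx : 0 ≤ x) (hx1 : x ≤ 1) : |y.eval x| ≤ |y.eval 1| := by
  set g : ℝ[X] := C L * y ^ 2 + (1 - X ^ 2) * derivative y ^ 2 with hg
  have hd : derivative g = C (2 * (2 * a - 1)) * X * derivative y ^ 2 := by
    simp only [hg, derivative_add, derivative_mul, derivative_pow, derivative_C, derivative_sub,
      derivative_one, derivative_X]
    simp [show (C 2 : ℝ[X]) = 2 from rfl] at hy ⊢
    linear_combination -2 * derivative y * hy
  have hmono : MonotoneOn (fun t => g.eval t) (Icc 0 1) := by
    apply monotoneOn_of_deriv_nonneg (convex_Icc 0 1) g.continuous.continuousOn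
      g.differentiable.differentiableOn
    intro t ht
    rw [interior_Icc] at ht
    rw [Polynomial.deriv, hd]
    simp only [eval_mul, eval_C, eval_X, eval_pow]
    have := ht.1
    have h2 : 0 ≤ 2 * (2 * a - 1) := by linarith
    positivity
  have h := hmono ⟨hx, hx1⟩ ⟨zero_le_one, le_refl _⟩ hx1
  simp only [hg, eval_add, eval_mul, eval_C, eval_pow, eval_sub, eval_one, eval_X] at h
  apply sq_le_sq.mp
  have h2 : 0 ≤ (1 - x ^ 2) * (eval x (derivative y)) ^ 2 :=
    mul_nonneg (by nlinarith) (sq_nonneg _)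
  nlinarith

open Polynomial in
theorem eval_one_iterate_derivative_sq_sub_one_pow (k : ℕ) :
    (derivative^[k] ((X ^ 2 - 1 : ℝ[X]) ^ k)).eval 1 = 2 ^ k * k.factorial := by
  rw [← factorial_smul_hasseDeriv, LinearMap.smul_apply, eval_smul, ← taylor_coeff]
  have : taylor 1 ((X ^ 2 - 1 : ℝ[X]) ^ k) = X ^ k * (X + C 2) ^ k := by
    rw [taylor_apply, pow_comp, ← mul_pow]
    congr 1
    simp
    have : (C 2 : ℝ[X]) = 2 := rfl
    rw [this]; ring
  rw [this, coeff_X_pow_mul', if_pos le_rfl, Nat.sub_self, coeff_zero_eq_eval_zero]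
  simp [mul_comm]

open Polynomial in
/-- The value at `1` of the derivatives of the (unnormalised) Legendre polynomials. -/
theorem eval_one_iterate_derivative_succ (k i : ℕ) :
    2 * (i + 1 : ℝ) * (derivative^[k + (i + 1)] ((X ^ 2 - 1 : ℝ[X]) ^ k)).eval 1 =
      ((k : ℝ) - i) * (k + i + 1) * (derivative^[k + i] ((X ^ 2 - 1 : ℝ[X]) ^ k)).eval 1 := by
  have h := congrArg (eval 1) (iterate_derivative_sq_sub_one_pow_ode k (k + i))
  simp only [eval_add, eval_mul, eval_sub, eval_pow, eval_X, eval_one, eval_C, eval_zero] at h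
  push_cast at h
  rw [← add_assoc]
  linear_combination h

open Polynomial in
theorem abs_eval_iterate_derivative_le (k i : ℕ) {x : ℝ} (hx : x ∈ Icc (-1 : ℝ) 1) :
    |(derivative^[k + i] ((X ^ 2 - 1 : ℝ[X]) ^ k)).eval x| ≤
      |(derivative^[k + i] ((X ^ 2 - 1 : ℝ[X]) ^ k)).eval 1| := by
  rcases lt_or_ge i k with hik | hik
  · have key : ∀ z : ℝ, 0 ≤ z → z ≤ 1 → |(derivative^[k + i] ((X ^ 2 - 1 : ℝ[X]) ^ k)).eval z| ≤
      |(derivative^[k + i] ((X ^ 2 - 1 : ℝ[X]) ^ k)).eval 1| := by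
      intro z hz hz1
      have hik' : (i : ℝ) < k := by exact_mod_cast hik
      refine abs_eval_le_abs_eval_one_of_ode _ (a := i + 1) (L := ((k : ℝ) - i) * (k + i + 1))
        (by have : (0 : ℝ) ≤ i := by positivity
            linarith) (mul_pos (by linarith) (by positivity)) ?_ hz hz1
      have h := iterate_derivative_sq_sub_one_pow_ode k (k + i)
      simp only [← Function.iterate_succ_apply' derivative]
      simp [show (C 2 : ℝ[X]) = 2 from rfl] at h ⊢
      linear_combination h
    rcases le_total 0 x with h0 | h0
    · exact key x h0 hx.2
    · have h := key (-x) (by linarith) (by linarith [hx.1])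
      have h2 := congrArg (eval x) (iterate_derivative_comp_neg_X ((X ^ 2 - 1 : ℝ[X]) ^ k) (k + i))
      have h3 : ((X ^ 2 - 1 : ℝ[X]) ^ k).comp (-X) = (X ^ 2 - 1 : ℝ[X]) ^ k := by simp
      rw [h3, eval_comp] at h2
      simp only [eval_neg, eval_X, eval_mul, eval_C] at h2
      rw [h2, abs_mul] at h
      simpa using h
  · have hdeg : (derivative^[k + i] ((X ^ 2 - 1 : ℝ[X]) ^ k)).natDegree = 0 := by
      have h1 := natDegree_iterate_derivative ((X ^ 2 - 1 : ℝ[X]) ^ k) (k + i)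
      have h2 : ((X ^ 2 - 1 : ℝ[X]) ^ k).natDegree ≤ k * 2 := by
        refine natDegree_pow_le_of_le k ?_
        compute_degree
      omega
    rw [eq_C_of_natDegree_eq_zero hdeg]
    simp

open Polynomial in
theorem iterate_derivative_legendre (k r : ℕ) :
    derivative^[r] (legendre k) =
      C (Real.sqrt ((k : ℝ) + 1 / 2) * ((2 : ℝ) ^ k * (k.factorial : ℝ))⁻¹) *
        derivative^[k + r] ((X ^ 2 - 1 : ℝ[X]) ^ k) := by
  rw [legendre, iterate_derivative_C_mul, add_comm k r, Function.iterate_add_apply]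

open Polynomial in
theorem eval_one_legendre (k : ℕ) : (legendre k).eval 1 = Real.sqrt ((k : ℝ) + 1 / 2) := by
  rw [legendre, eval_mul, eval_C, eval_one_iterate_derivative_sq_sub_one_pow, mul_assoc,
    inv_mul_cancel₀ (by positivity), mul_one]

open Polynomial in
theorem eval_one_iterate_derivative_legendre_succ (k i : ℕ) :
    2 * (i + 1 : ℝ) * (derivative^[i + 1] (legendre k)).eval 1 =
      ((k : ℝ) - i) * (k + i + 1) * (derivative^[i] (legendre k)).eval 1 := by
  rw [iterate_derivative_legendre, iterate_derivative_legendre, eval_mul, eval_mul, eval_C]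
  linear_combination (Real.sqrt ((k : ℝ) + 1 / 2) * ((2 : ℝ) ^ k * (k.factorial : ℝ))⁻¹) *
    eval_one_iterate_derivative_succ k i

open Polynomial in
theorem abs_eval_iterate_derivative_legendre_le (k r : ℕ) {x : ℝ} (hx : x ∈ Icc (-1 : ℝ) 1) :
    |(derivative^[r] (legendre k)).eval x| ≤ |(derivative^[r] (legendre k)).eval 1| := by
  rw [iterate_derivative_legendre, eval_mul, eval_mul, abs_mul, abs_mul, eval_C, eval_C]
  exact mul_le_mul_of_nonneg_left (abs_eval_iterate_derivative_le k r hx) (abs_nonneg _)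

open Polynomial in
theorem abs_eval_one_iterate_derivative_legendre_le (r k : ℕ) :
    |(derivative^[r] (legendre k)).eval 1| ≤
      2 * (r + 1 : ℝ) ^ (2 * r) * ((max 1 k : ℕ) : ℝ) ^ (2 * (r : ℝ) + 1 / 2) := by
  set M : ℝ := ((max 1 k : ℕ) : ℝ) with hM
  have hM1 : 1 ≤ M := by simp [hM]
  have hkM : (k : ℝ) ≤ M := by simp [hM]
  have main : ∀ i : ℕ, i ≤ r → |(derivative^[i] (legendre k)).eval 1| ≤
      2 * (r + 1 : ℝ) ^ (2 * i) * M ^ (2 * i) * M ^ (1 / 2 : ℝ) := by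
    intro i
    induction i with
    | zero =>
      intro _
      simp only [Function.iterate_zero, id_eq, mul_zero, pow_zero, mul_one]
      rw [eval_one_legendre, abs_of_nonneg (Real.sqrt_nonneg _), Real.sqrt_eq_rpow]
      calc ((k : ℝ) + 1 / 2) ^ (1 / 2 : ℝ) ≤ (4 * M) ^ (1 / 2 : ℝ) := by
            apply Real.rpow_le_rpow (by positivity) (by linarith) (by norm_num)
        _ = 2 * M ^ (1 / 2 : ℝ) := by
            rw [Real.mul_rpow (by norm_num) (by linarith), ← Real.sqrt_eq_rpow 4,
              show (4 : ℝ) = 2 ^ 2 by norm_num, Real.sqrt_sq (by norm_num)]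
    | succ i ih =>
      intro hi
      have ih' := ih (by omega)
      have hir : (i : ℝ) + 1 ≤ r := by exact_mod_cast hi
      have hrec := eval_one_iterate_derivative_legendre_succ k i
      have h1 : |(derivative^[i + 1] (legendre k)).eval 1| =
          |((k : ℝ) - i) * (k + i + 1)| / (2 * (i + 1)) * |(derivative^[i] (legendre k)).eval 1| := by
        have hpos : (0 : ℝ) < 2 * (i + 1) := by positivity
        have := congrArg abs hrec
        rw [abs_mul, abs_mul _ (eval 1 _), abs_of_pos hpos] at this
        field_simp
        linarith
      have h2 : |((k : ℝ) - i) * (k + i + 1)| / (2 * (i + 1)) ≤ (r + 1 : ℝ) ^ 2 * M ^ 2 := by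
        rw [div_le_iff₀ (by positivity), abs_mul, abs_of_pos (by positivity : (0 : ℝ) < k + i + 1)]
        have hi0 : (0 : ℝ) ≤ i := by positivity
        have hk0 : (0 : ℝ) ≤ k := by positivity
        have a1 : |(k : ℝ) - i| ≤ (r + 1) * M := by
          rw [abs_le]; constructor <;> nlinarith
        have a2 : (k : ℝ) + i + 1 ≤ (r + 1) * M := by nlinarith
        calc |(k : ℝ) - i| * (k + i + 1) ≤ ((r + 1) * M) * ((r + 1) * M) := by gcongr
          _ = ((r + 1 : ℝ) ^ 2 * M ^ 2) * 1 := by ring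
          _ ≤ _ := by gcongr; linarith
      rw [h1]
      calc _ ≤ ((r + 1 : ℝ) ^ 2 * M ^ 2) * (2 * (r + 1 : ℝ) ^ (2 * i) * M ^ (2 * i) * M ^ (1 / 2 : ℝ)) := by
            gcongr
        _ = _ := by rw [Nat.mul_succ]; ring
  have h := main r le_rfl
  rw [Real.rpow_add (by linarith), show (2 * (r : ℝ)) = ((2 * r : ℕ) : ℝ) by push_cast; ring,
    Real.rpow_natCast]
  linarith

open Polynomial in
theorem le_eval_one_iterate_derivative_legendre (r k : ℕ) (hk : 1 ≤ k) (hrk : 2 * r ≤ k) :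
    ((4 * (r + 1 : ℝ)) ^ r)⁻¹ * (k : ℝ) ^ (2 * (r : ℝ) + 1 / 2) ≤
      (derivative^[r] (legendre k)).eval 1 := by
  have hk0 : (0 : ℝ) < k := by exact_mod_cast hk
  have main : ∀ i : ℕ, i ≤ r → ((4 * (r + 1 : ℝ)) ^ i)⁻¹ * (k : ℝ) ^ (2 * i) * (k : ℝ) ^ (1 / 2 : ℝ) ≤
      (derivative^[i] (legendre k)).eval 1 := by
    intro i
    induction i with
    | zero =>
      intro _
      simp only [Function.iterate_zero, id_eq, mul_zero, pow_zero, mul_one, inv_one, one_mul]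
      rw [eval_one_legendre, Real.sqrt_eq_rpow]
      gcongr
      linarith
    | succ i ih =>
      intro hi
      have ih' := ih (by omega)
      have hir : (i : ℝ) + 1 ≤ r := by exact_mod_cast hi
      have hrk' : 2 * (r : ℝ) ≤ k := by exact_mod_cast hrk
      have hi0 : (0 : ℝ) ≤ i := by positivity
      have hrec := eval_one_iterate_derivative_legendre_succ k i
      have h1 : (derivative^[i + 1] (legendre k)).eval 1 =
          (((k : ℝ) - i) * (k + i + 1)) / (2 * (i + 1)) * (derivative^[i] (legendre k)).eval 1 := by
        field_simp
        linarith
      have h2 : (4 * (r + 1 : ℝ))⁻¹ * (k : ℝ) ^ 2 ≤ (((k : ℝ) - i) * (k + i + 1)) / (2 * (i + 1)) := by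
        rw [inv_mul_eq_div, div_le_div_iff₀ (by positivity) (by positivity)]
        have a1 : (k : ℝ) / 2 ≤ k - i := by linarith
        have a2 : (k : ℝ) ≤ k + i + 1 := by linarith
        have a3 : (k : ℝ) / 2 * k ≤ (k - i) * (k + i + 1) := by gcongr; linarith
        calc (k : ℝ) ^ 2 * (2 * (i + 1)) = (k : ℝ) / 2 * k * (4 * (i + 1)) := by ring
          _ ≤ (k - i) * (k + i + 1) * (4 * (r + 1)) := by
            have : (0 : ℝ) ≤ (k - i) := by linarith
            gcongr
            linarith
      rw [h1]
      calc _ = ((4 * (r + 1 : ℝ))⁻¹ * (k : ℝ) ^ 2) *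
            (((4 * (r + 1 : ℝ)) ^ i)⁻¹ * (k : ℝ) ^ (2 * i) * (k : ℝ) ^ (1 / 2 : ℝ)) := by
            rw [Nat.mul_succ, pow_succ, mul_inv]; ring
        _ ≤ _ := by
            gcongr
            exact div_nonneg (mul_nonneg (by linarith) (by positivity)) (by positivity)
  have h := main r le_rfl
  rw [Real.rpow_add hk0, show (2 * (r : ℝ)) = ((2 * r : ℕ) : ℝ) by push_cast; ring,
    Real.rpow_natCast]
  linarith

open Polynomial in
/-- The Legendre polynomials are pairwise orthogonal on `[-1,1]`. -/
theorem integral_legendre_mul_eq_zero {k j : ℕ} (hkj : k ≠ j) :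
    ∫ x in Icc (-1 : ℝ) 1, (legendre k).eval x * (legendre j).eval x = 0 := by
  have ode : ∀ n : ℕ, (X ^ 2 - 1) * derivative (derivative (legendre n)) +
      C 2 * X * derivative (legendre n) - C ((n : ℝ) * (n + 1)) * legendre n = 0 := by
    intro n
    have h := iterate_derivative_sq_sub_one_pow_ode n n
    have h0 := iterate_derivative_legendre n 0
    have h1 := iterate_derivative_legendre n 1
    have h2 := iterate_derivative_legendre n 2
    simp only [Function.iterate_succ, Function.iterate_zero, Function.comp_apply, id_eq,
      add_zero] at h0 h1 h2
    rw [h2, h1, h0]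
    generalize √((n : ℝ) + 1 / 2) * (2 ^ n * (n.factorial : ℝ))⁻¹ = c
    simp [show (C 2 : ℝ[X]) = 2 from rfl] at h ⊢
    linear_combination C c * h
  set W : ℝ[X] := (X ^ 2 - 1) *
    (derivative (legendre k) * legendre j - legendre k * derivative (legendre j)) with hW
  have hd : derivative W = C ((k : ℝ) * (k + 1) - j * (j + 1)) * (legendre k * legendre j) := by
    have hk := ode k
    have hj := ode j
    simp only [hW, derivative_mul, derivative_sub, derivative_X_pow, derivative_one]
    simp [show (C 2 : ℝ[X]) = 2 from rfl] at hk hj ⊢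
    linear_combination legendre j * hk - legendre k * hj
  have hne : ((k : ℝ) * (k + 1) - j * (j + 1)) ≠ 0 := by
    have h : ((k : ℝ) - j) ≠ 0 := sub_ne_zero.mpr (by exact_mod_cast hkj)
    have h2 : ((k : ℝ) + j + 1) ≠ 0 := by positivity
    have : ((k : ℝ) * (k + 1) - j * (j + 1)) = (k - j) * (k + j + 1) := by ring
    rw [this]; exact mul_ne_zero h h2
  have hint : ∫ x in (-1 : ℝ)..1, (derivative W).eval x = W.eval 1 - W.eval (-1) :=
    intervalIntegral.integral_eq_sub_of_hasDerivAt (fun x _ => W.hasDerivAt x)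
      ((derivative W).continuous.intervalIntegrable _ _)
  rw [hd] at hint
  simp only [hW, eval_mul, eval_C, eval_sub, eval_pow, eval_X, eval_one] at hint
  rw [intervalIntegral.integral_const_mul, intervalIntegral.integral_of_le (by norm_num),
    ← integral_Icc_eq_integral_Ioc] at hint
  norm_num at hint
  rcases hint with h | h
  · exact absurd h hne
  · exact h

open Polynomial in
theorem integral_legendre_sq_pos (k : ℕ) :
    0 < ∫ x in Icc (-1 : ℝ) 1, (legendre k).eval x * (legendre k).eval x := by
  rw [integral_Icc_eq_integral_Ioc, ← intervalIntegral.integral_of_le (by norm_num)]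
  apply intervalIntegral.integral_pos (by norm_num) (by fun_prop)
  · intro x _
    exact mul_self_nonneg _
  · refine ⟨1, by norm_num, ?_⟩
    rw [eval_one_legendre]
    positivity

theorem coeff_finset_sum_eq (S : Finset (ℕ × ℕ)) (b : ℕ × ℕ → ℝ) (q : ℕ × ℕ) :
    coeff (fun x => ∑ a ∈ S, b a * ((legendre a.1).eval x.1 * (legendre a.2).eval x.2)) q =
      if q ∈ S then b q * ((∫ x in Icc (-1 : ℝ) 1, (legendre q.1).eval x * (legendre q.1).eval x) *
        ∫ x in Icc (-1 : ℝ) 1, (legendre q.2).eval x * (legendre q.2).eval x) else 0 := by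
  have hprod : ∀ a : ℕ × ℕ, ∫ x in square, ((legendre a.1).eval x.1 * (legendre q.1).eval x.1) *
      ((legendre a.2).eval x.2 * (legendre q.2).eval x.2) =
      (∫ x in Icc (-1 : ℝ) 1, (legendre a.1).eval x * (legendre q.1).eval x) *
        ∫ x in Icc (-1 : ℝ) 1, (legendre a.2).eval x * (legendre q.2).eval x := by
    intro a
    exact setIntegral_prod_mul (μ := volume) (ν := volume)
      (fun x : ℝ => (legendre a.1).eval x * (legendre q.1).eval x)
      (fun x : ℝ => (legendre a.2).eval x * (legendre q.2).eval x) (Icc (-1) 1) (Icc (-1) 1)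
  have hsq : IsCompact square := isCompact_Icc.prod isCompact_Icc
  unfold coeff
  have h1 : ∀ x : ℝ × ℝ, (∑ a ∈ S, b a * ((legendre a.1).eval x.1 * (legendre a.2).eval x.2)) *
      ((legendre q.1).eval x.1 * (legendre q.2).eval x.2) =
      ∑ a ∈ S, b a * (((legendre a.1).eval x.1 * (legendre q.1).eval x.1) *
      ((legendre a.2).eval x.2 * (legendre q.2).eval x.2)) := by
    intro x
    rw [Finset.sum_mul]
    exact Finset.sum_congr rfl fun a _ => by ring
  simp_rw [h1]
  rw [integral_finsetSum]
  · simp_rw [integral_const_mul, hprod]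
    rw [← Finset.sum_ite_eq' S q
      (fun a => b a * ((∫ x in Icc (-1 : ℝ) 1, (legendre a.1).eval x * (legendre a.1).eval x) *
        ∫ x in Icc (-1 : ℝ) 1, (legendre a.2).eval x * (legendre a.2).eval x))]
    refine Finset.sum_congr rfl fun a _ => ?_
    split_ifs with h
    · rw [h]
    · by_cases h1 : a.1 = q.1
      · have h2 : a.2 ≠ q.2 := fun h2 => h (Prod.ext h1 h2)
        rw [integral_legendre_mul_eq_zero h2]; simp
      · rw [integral_legendre_mul_eq_zero h1]; simp
  · intro a _
    apply ContinuousOn.integrableOn_compact hsq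
    fun_prop

/-- Every finitely supported family is the family of Fourier-Legendre coefficients of a
square-integrable function. -/
theorem exists_coeff_eq (S : Finset (ℕ × ℕ)) (b : ℕ × ℕ → ℝ) :
    ∃ f : ℝ × ℝ → ℝ, MemLp f 2 (volume.restrict square) ∧
      ∀ q, coeff f q = if q ∈ S then b q else 0 := by
  set c : ℕ × ℕ → ℝ := fun q =>
    (∫ x in Icc (-1 : ℝ) 1, (legendre q.1).eval x * (legendre q.1).eval x) *
        ∫ x in Icc (-1 : ℝ) 1, (legendre q.2).eval x * (legendre q.2).eval x with hc
  have hsq : IsCompact square := isCompact_Icc.prod isCompact_Icc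
  refine ⟨fun x => ∑ a ∈ S, (b a / c a) * ((legendre a.1).eval x.1 * (legendre a.2).eval x.2),
    ?_, ?_⟩
  · have : IsFiniteMeasure (volume.restrict square : Measure (ℝ × ℝ)) :=
      ⟨by rw [Measure.restrict_apply_univ]; exact hsq.measure_lt_top⟩
    have hcont : Continuous (fun x : ℝ × ℝ => ∑ a ∈ S, (b a / c a) *
        ((legendre a.1).eval x.1 * (legendre a.2).eval x.2)) := by fun_prop
    obtain ⟨C, hC⟩ := hsq.exists_bound_of_continuousOn hcont.continuousOn
    refine MemLp.of_bound hcont.aestronglyMeasurable C ?_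
    exact ae_restrict_of_forall_mem hsq.measurableSet hC
  · intro q
    rw [coeff_finset_sum_eq]
    split_ifs
    · have : c q ≠ 0 := (mul_pos (integral_legendre_sq_pos _) (integral_legendre_sq_pos _)).ne'
      change b q / c q * c q = b q
      field_simp
    · rfl

theorem norm_derivBasis_le (r : ℕ) : ∃ C : ℝ, 0 < C ∧ ∀ q : ℕ × ℕ, ‖derivBasis r q‖ ≤
    C * (((max 1 q.1 : ℕ) : ℝ) ^ (1 / 2 : ℝ) * ((max 1 q.2 : ℕ) : ℝ) ^ (2 * (r : ℝ) + 1 / 2)) := by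
  refine ⟨2 * (2 * (r + 1 : ℝ) ^ (2 * r)), by positivity, fun q => ?_⟩
  rw [ContinuousMap.norm_le _ (by positivity)]
  rintro ⟨⟨t, u⟩, ht, hu⟩
  change |(legendre q.1).eval t * (Polynomial.derivative^[r] (legendre q.2)).eval u| ≤ _
  have h1 := (abs_eval_iterate_derivative_legendre_le q.1 0 ht).trans
    (abs_eval_one_iterate_derivative_legendre_le 0 q.1)
  have h2 := (abs_eval_iterate_derivative_legendre_le q.2 r hu).trans
    (abs_eval_one_iterate_derivative_legendre_le r q.2)
  simp only [Function.iterate_zero, id_eq, CharP.cast_eq_zero, zero_add, mul_zero, pow_zero,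
    mul_one] at h1
  rw [abs_mul]
  calc _ ≤ (2 * ((max 1 q.1 : ℕ) : ℝ) ^ (1 / 2 : ℝ)) * (2 * (r + 1 : ℝ) ^ (2 * r) *
        ((max 1 q.2 : ℕ) : ℝ) ^ (2 * (r : ℝ) + 1 / 2)) := by
        gcongr
    _ = _ := by ring


theorem rpow_neg_sub_one_le_sub {a : ℝ} (ha : 0 < a) {j : ℕ} (hj : 1 ≤ j) :
    a * ((j : ℝ) + 1) ^ (-a - 1) ≤ (j : ℝ) ^ (-a) - ((j : ℝ) + 1) ^ (-a) := by
  have hj0 : (0 : ℝ) < j := by exact_mod_cast hj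
  have h1 : (j : ℝ) ^ (-a) = ((j : ℝ) + 1) ^ (-a) * ((j : ℝ) / (j + 1)) ^ (-a) := by
    rw [← Real.mul_rpow (by positivity) (by positivity)]
    congr 1
    field_simp
  have h2 : 1 + a / (j + 1) ≤ ((j : ℝ) / (j + 1)) ^ (-a) := by
    rw [Real.rpow_def_of_pos (by positivity)]
    have h3 := Real.log_le_sub_one_of_pos (show 0 < (j : ℝ) / (j + 1) by positivity)
    have h4 : (j : ℝ) / (j + 1) - 1 = -(1 / (j + 1)) := by field_simp; ring
    have h5 := Real.add_one_le_exp (Real.log ((j : ℝ) / (j + 1)) * -a)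
    have h6 : a / ((j : ℝ) + 1) = a * (1 / (j + 1)) := by ring
    nlinarith
  rw [h1, Real.rpow_sub_one (by positivity)]
  have h3 : 0 < ((j : ℝ) + 1) ^ (-a) := by positivity
  have h4 := mul_le_mul_of_nonneg_left h2 h3.le
  have h5 : a * (((j : ℝ) + 1) ^ (-a) / (j + 1)) = ((j : ℝ) + 1) ^ (-a) * (a / (j + 1)) := by ring
  linarith

/-- Tail estimate for the series `∑ j^{-a-1}`. -/
theorem sum_rpow_tail_le {a : ℝ} (ha : 0 < a) {J : ℝ} (hJ : 0 < J) (S : Finset ℕ)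
    (hS : ∀ j ∈ S, 1 ≤ j ∧ J ≤ j) :
    ∑ j ∈ S, (j : ℝ) ^ (-a - 1) ≤ (1 + 2 ^ a / a) * J ^ (-a) := by
  have tail : ∀ m : ℕ, 1 ≤ m → ∀ n : ℕ, ∑ j ∈ Finset.Ico (m + 1) (m + 1 + n), (j : ℝ) ^ (-a - 1) ≤
      1 / a * ((m : ℝ) ^ (-a) - ((m + n : ℕ) : ℝ) ^ (-a)) := by
    intro m hm n
    induction n with
    | zero => simp
    | succ n ih =>
      rw [← add_assoc, Finset.sum_Ico_succ_top (by omega)]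
      have h := rpow_neg_sub_one_le_sub ha (j := m + n) (by omega)
      have h2 : ((m + 1 + n : ℕ) : ℝ) = ((m + n : ℕ) : ℝ) + 1 := by push_cast; ring
      have h3 : ((m + (n + 1) : ℕ) : ℝ) = ((m + n : ℕ) : ℝ) + 1 := by push_cast; ring
      rw [h2, h3]
      have h4 : (((m + n : ℕ) : ℝ) + 1) ^ (-a - 1) ≤
          1 / a * (((m + n : ℕ) : ℝ) ^ (-a) - (((m + n : ℕ) : ℝ) + 1) ^ (-a)) := by
        rw [one_div, inv_mul_eq_div, le_div_iff₀ ha]; linarith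
      linarith
  have tail' : ∀ m : ℕ, 1 ≤ m → ∀ S : Finset ℕ, (∀ j ∈ S, m + 1 ≤ j) →
      ∑ j ∈ S, (j : ℝ) ^ (-a - 1) ≤ 1 / a * (m : ℝ) ^ (-a) := by
    intro m hm S hS
    have hsub : S ⊆ Finset.Ico (m + 1) (m + 1 + (S.sup id + 1)) := by
      intro j hj
      rw [Finset.mem_Ico]
      refine ⟨hS j hj, ?_⟩
      have : j ≤ S.sup id := Finset.le_sup (f := id) hj
      omega
    refine (Finset.sum_le_sum_of_subset_of_nonneg hsub fun _ _ _ => by positivity).trans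
      ((tail m hm _).trans ?_)
    gcongr
    have : 0 ≤ ((m + (S.sup id + 1) : ℕ) : ℝ) ^ (-a) := by positivity
    linarith
  have h2a : (1 : ℝ) ≤ 2 ^ a := Real.one_le_rpow (by norm_num) ha.le
  rcases le_or_gt J 1 with hJ1 | hJ1
  · have h1 : ∑ j ∈ S, (j : ℝ) ^ (-a - 1) ≤ 1 + 1 / a := by
      have hsub : S ⊆ insert 1 (S.filter (fun j => 2 ≤ j)) := by
        intro j hj
        have := (hS j hj).1
        simp only [Finset.mem_insert, Finset.mem_filter]
        by_cases h : j = 1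
        · exact Or.inl h
        · exact Or.inr ⟨hj, by omega⟩
      refine (Finset.sum_le_sum_of_subset_of_nonneg hsub fun _ _ _ => by positivity).trans ?_
      rw [Finset.sum_insert (by simp)]
      have := tail' 1 le_rfl (S.filter (fun j => 2 ≤ j)) (by simp)
      simp at this ⊢
      linarith
    have h3 : 1 ≤ J ^ (-a) := Real.one_le_rpow_of_pos_of_le_one_of_nonpos hJ hJ1 (by linarith)
    calc _ ≤ (1 + 1 / a) * 1 := by linarith
      _ ≤ _ := by gcongr
  · set m := ⌈J⌉₊ - 1 with hm
    have hc1 : 1 < ⌈J⌉₊ := Nat.lt_ceil.mpr (by simpa using hJ1)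
    have hJm : J ≤ (m : ℝ) + 1 := by
      have := Nat.le_ceil J
      have h : ((m + 1 : ℕ) : ℝ) = ⌈J⌉₊ := by congr 1; omega
      push_cast at h
      linarith
    have hm1 : 1 ≤ m := by omega
    have hm1' : (1 : ℝ) ≤ m := by exact_mod_cast hm1
    have h := tail' m hm1 S (fun j hj => by
      have := Nat.ceil_le.mpr (hS j hj).2
      omega)
    have h3 : (m : ℝ) ^ (-a) ≤ (J / 2) ^ (-a) :=
      Real.rpow_le_rpow_of_nonpos (by positivity) (by linarith) (by linarith)
    have h4 : (J / 2) ^ (-a) = 2 ^ a * J ^ (-a) := by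
      rw [Real.div_rpow hJ.le (by norm_num), Real.rpow_neg (by norm_num : (0 : ℝ) ≤ 2)]
      field_simp
    rw [h4] at h3
    have h5 : 0 < J ^ (-a) := by positivity
    calc _ ≤ 1 / a * (2 ^ a * J ^ (-a)) := h.trans (by gcongr)
      _ = (2 ^ a / a) * J ^ (-a) := by ring
      _ ≤ _ := by nlinarith

theorem sum_abs_le_card_rpow_mul_norm {ι : Type*} {p : ℝ≥0∞} (hp : 1 ≤ p)
    (ξ : lp (fun _ : ι => ℝ) p) (S : Finset ι) :
    ∑ i ∈ S, |ξ i| ≤ (S.card : ℝ) ^ (1 - (p⁻¹).toReal) * ‖ξ‖ := by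
  have hp0 : p ≠ 0 := (zero_lt_one.trans_le hp).ne'
  have hξ := lp.norm_nonneg' ξ
  rcases eq_or_ne p ⊤ with rfl | htop
  · have : ∑ i ∈ S, |ξ i| ≤ ∑ i ∈ S, ‖ξ‖ :=
      Finset.sum_le_sum fun i _ => lp.norm_apply_le_norm hp0 ξ i
    simpa using this
  · have hpr : 1 ≤ p.toReal := by
      rw [← ENNReal.toReal_one]; exact ENNReal.toReal_mono htop hp
    have hp0' : 0 < p.toReal := by linarith
    have h1 := Real.rpow_sum_le_const_mul_sum_rpow S (fun i => ξ i) hpr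
    have h2 := lp.sum_rpow_le_norm_rpow hp0' ξ S
    simp only [Real.norm_eq_abs] at h2
    have h3 : (∑ i ∈ S, |ξ i|) ^ p.toReal ≤ (S.card : ℝ) ^ (p.toReal - 1) * ‖ξ‖ ^ p.toReal :=
      h1.trans (by gcongr)
    rw [ENNReal.toReal_inv]
    have h4 : ((S.card : ℝ) ^ (1 - p.toReal⁻¹) * ‖ξ‖) ^ p.toReal =
        (S.card : ℝ) ^ (p.toReal - 1) * ‖ξ‖ ^ p.toReal := by
      rw [Real.mul_rpow (by positivity) hξ, ← Real.rpow_mul (by positivity)]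
      congr 2
      field_simp
    rw [← h4] at h3
    exact (Real.rpow_le_rpow_iff (Finset.sum_nonneg fun _ _ => abs_nonneg _)
      (mul_nonneg (by positivity) hξ) hp0').mp h3

theorem sum_eq_sum_fibers (F : Finset (ℕ × ℕ)) (g : ℕ × ℕ → ℝ) :
    ∑ q ∈ F, g q = ∑ k ∈ F.image Prod.fst,
      ∑ j ∈ (F.image Prod.snd).filter (fun j => (k, j) ∈ F), g (k, j) := by
  apply Finset.sum_finset_product
  intro q
  simp only [Finset.mem_image, Finset.mem_filter]
  constructor
  · intro h
    exact ⟨⟨q, h, rfl⟩, ⟨q, h, rfl⟩, h⟩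
  · exact fun h => h.2.2

theorem summable_max_one_rpow {a : ℝ} (ha : a < -1) :
    Summable (fun k : ℕ => ((max 1 k : ℕ) : ℝ) ^ a) := by
  refine (summable_nat_add_iff 1).mp ?_
  have := (summable_nat_add_iff 1).mpr (Real.summable_nat_rpow.mpr ha)
  refine this.congr fun k => ?_
  congr 2

/-- Bound for the sum of a unit ball of `ℓ_s` weighted by `k^{-λ-1/s'} j^{-κ-1/s'}` outside
a hyperbolic cross. -/
theorem sum_outside_cross_le {s γ κ lam : ℝ} (hs : 1 ≤ s) (hκ : 0 < κ) (hγ : γ * κ < lam) :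
    ∃ C : ℝ, 0 < C ∧ ∀ (a : ℕ × ℕ → ℝ) (T : ℝ) (F : Finset (ℕ × ℕ)), 0 < T → (∀ q, 0 ≤ a q) →
      (∀ q ∈ F, 1 ≤ q.2 ∧ T ≤ ((max 1 q.1 : ℕ) : ℝ) ^ γ * q.2) → ∑ q ∈ F, a q ^ s ≤ 1 →
      ∑ q ∈ F, a q * (((max 1 q.1 : ℕ) : ℝ) ^ (-lam - (1 - 1 / s)) *
        (q.2 : ℝ) ^ (-κ - (1 - 1 / s))) ≤ C * T ^ (-κ) := by
  have hm1 : ∀ k : ℕ, (1 : ℝ) ≤ ((max 1 k : ℕ) : ℝ) := fun k => by simp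
  have hm : ∀ k : ℕ, (0 : ℝ) < ((max 1 k : ℕ) : ℝ) := fun k => by linarith [hm1 k]
  rcases hs.eq_or_lt with rfl | hs1
  · refine ⟨1, one_pos, fun a T F hT ha hF hsum => ?_⟩
    simp only [Real.rpow_one, div_one, sub_self, sub_zero] at hsum ⊢
    calc _ ≤ ∑ q ∈ F, a q * T ^ (-κ) := by
          refine Finset.sum_le_sum fun q hq => mul_le_mul_of_nonneg_left ?_ (ha q)
          obtain ⟨h1, h2⟩ := hF q hq
          have hq0 : (0 : ℝ) < q.2 := by exact_mod_cast h1
          calc _ ≤ ((max 1 q.1 : ℕ) : ℝ) ^ (γ * -κ) * (q.2 : ℝ) ^ (-κ) := by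
                gcongr
                · exact hm1 _
                · linarith
            _ = (((max 1 q.1 : ℕ) : ℝ) ^ γ * q.2) ^ (-κ) := by
                rw [Real.mul_rpow (by have := hm q.1; positivity) hq0.le,
                  ← Real.rpow_mul (hm q.1).le]
            _ ≤ T ^ (-κ) := Real.rpow_le_rpow_of_nonpos hT h2 (by linarith)
      _ ≤ 1 * T ^ (-κ) := by
          rw [← Finset.sum_mul]
          gcongr
  · set t : ℝ := s.conjExponent with ht
    have hc : s.HolderConjugate t := Real.HolderConjugate.conjExponent hs1
    have ht1 : 1 < t := hc.symm.lt
    have ht0 : 0 < t := by linarith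
    have hinv : 1 - 1 / s = 1 / t := by
      have := hc.inv_add_inv_eq_one
      simp only [one_div]; linarith
    rw [hinv]
    have hexp : -(lam - γ * κ) * t - 1 < -1 := by
      have : 0 < (lam - γ * κ) * t := mul_pos (by linarith) ht0
      linarith
    have hsummable := summable_max_one_rpow hexp
    set S₀ : ℝ := ∑' k : ℕ, ((max 1 k : ℕ) : ℝ) ^ (-(lam - γ * κ) * t - 1) 
    set A : ℝ := 1 + 2 ^ (κ * t) / (κ * t) with hA
    have hA0 : 0 < A := by positivity
    have hS0 : 0 < S₀ := hsummable.tsum_pos (fun k => by positivity) 0 (by simp)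
    refine ⟨(A * S₀) ^ (1 / t), by positivity, fun a T F hT ha hF hsum => ?_⟩
    refine (Real.inner_le_Lp_mul_Lq_of_nonneg F hc (fun q _ => ha q)
      (fun q _ => by positivity)).trans ?_
    have h1 : (∑ q ∈ F, a q ^ s) ^ (1 / s) ≤ 1 := by
      apply Real.rpow_le_one (Finset.sum_nonneg fun q _ => Real.rpow_nonneg (ha q) _) hsum
      positivity
    have h2 : ∑ q ∈ F, (((max 1 q.1 : ℕ) : ℝ) ^ (-lam - 1 / t) *
        (q.2 : ℝ) ^ (-κ - 1 / t)) ^ t ≤ (A * S₀) * T ^ (-κ * t) := by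
      have heq : ∀ q : ℕ × ℕ, (((max 1 q.1 : ℕ) : ℝ) ^ (-lam - 1 / t) *
        (q.2 : ℝ) ^ (-κ - 1 / t)) ^ t = ((max 1 q.1 : ℕ) : ℝ) ^ (-lam * t - 1) *
          (q.2 : ℝ) ^ (-(κ * t) - 1) := by
        intro q
        rw [Real.mul_rpow (by positivity) (by positivity), ← Real.rpow_mul (by positivity),
          ← Real.rpow_mul (by positivity)]
        congr 2 <;> field_simp
      simp_rw [heq]
      rw [sum_eq_sum_fibers]
      calc _ ≤ ∑ k ∈ F.image Prod.fst, ((max 1 k : ℕ) : ℝ) ^ (-lam * t - 1) *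
            (A * (T / ((max 1 k : ℕ) : ℝ) ^ γ) ^ (-(κ * t))) := by
            refine Finset.sum_le_sum fun k _ => ?_
            simp only
            rw [← Finset.mul_sum]
            refine mul_le_mul_of_nonneg_left ?_ (by positivity)
            have := hm k
            apply sum_rpow_tail_le (by positivity) (by positivity)
            intro j hj
            obtain ⟨h1, h2⟩ := hF _ (Finset.mem_filter.mp hj).2
            refine ⟨h1, ?_⟩
            rw [div_le_iff₀ (by positivity)]
            linarith
        _ = ∑ k ∈ F.image Prod.fst, A * T ^ (-κ * t) *
              ((max 1 k : ℕ) : ℝ) ^ (-(lam - γ * κ) * t - 1) := by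
            refine Finset.sum_congr rfl fun k _ => ?_
            have := hm k
            rw [Real.div_rpow hT.le (by positivity), ← Real.rpow_mul this.le, div_eq_mul_inv,
              ← Real.rpow_neg this.le]
            have h3 : ((max 1 k : ℕ) : ℝ) ^ (-(lam - γ * κ) * t - 1) =
                ((max 1 k : ℕ) : ℝ) ^ (-lam * t - 1) * ((max 1 k : ℕ) : ℝ) ^ (-(γ * -(κ * t))) := by
              rw [← Real.rpow_add this]; congr 1; ring
            rw [h3, neg_mul κ t]; ring
        _ = A * T ^ (-κ * t) * ∑ k ∈ F.image Prod.fst,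
              ((max 1 k : ℕ) : ℝ) ^ (-(lam - γ * κ) * t - 1) := by rw [Finset.mul_sum]
        _ ≤ A * T ^ (-κ * t) * S₀ := by
            gcongr
            exact hsummable.sum_le_tsum _ (fun _ _ => by positivity)
        _ = _ := by ring
    calc _ ≤ 1 * ((A * S₀) * T ^ (-κ * t)) ^ (1 / t) := by
          gcongr
      _ = _ := by
          rw [one_mul, Real.mul_rpow (by positivity) (by positivity), ← Real.rpow_mul hT.le]
          congr 2
          field_simp

/-- Bound for the sum of an `ℓ_p` sequence weighted by `k^{1/2} j^β` over a hyperbolic cross. -/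
theorem sum_inside_cross_le {p : ℝ≥0∞} (hp : 1 ≤ p) {β : ℝ} (hβ : 3 / 2 < β) :
    ∃ C : ℝ, 0 < C ∧ ∀ (ξ : lp (fun _ : ℕ × ℕ => ℝ) p) (γ T : ℝ) (F : Finset (ℕ × ℕ)), 1 ≤ γ →
      0 < T → (∀ q ∈ F, 1 ≤ q.2 ∧ ((max 1 q.1 : ℕ) : ℝ) ^ γ * q.2 ≤ T) →
      ∑ q ∈ F, |ξ q| * (((max 1 q.1 : ℕ) : ℝ) ^ (1 / 2 : ℝ) * (q.2 : ℝ) ^ β) ≤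
        C * (‖ξ‖ * T ^ (β + (1 - (p⁻¹).toReal))) := by
  have hm1 : ∀ k : ℕ, (1 : ℝ) ≤ ((max 1 k : ℕ) : ℝ) := fun k => by simp
  have hm : ∀ k : ℕ, (0 : ℝ) < ((max 1 k : ℕ) : ℝ) := fun k => by linarith [hm1 k]
  have hp1 : (p⁻¹).toReal ≤ 1 := by
    rw [← ENNReal.toReal_one]
    exact ENNReal.toReal_mono ENNReal.one_ne_top (ENNReal.inv_le_one.mpr hp)
  set θ : ℝ := β + (1 - (p⁻¹).toReal) with hθ
  have hexp : 1 / 2 - θ < -1 := by linarith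
  have hsummable := summable_max_one_rpow hexp
  refine ⟨∑' k : ℕ, ((max 1 k : ℕ) : ℝ) ^ (1 / 2 - θ),
    hsummable.tsum_pos (fun k => by positivity) 0 (by simp), fun ξ γ T F hγ hT hF => ?_⟩
  have hξ := lp.norm_nonneg' ξ
  rw [sum_eq_sum_fibers]
  calc _ ≤ ∑ k ∈ F.image Prod.fst, ‖ξ‖ * T ^ θ * ((max 1 k : ℕ) : ℝ) ^ (1 / 2 - θ) := by
        refine Finset.sum_le_sum fun k _ => ?_
        simp only
        set G := (F.image Prod.snd).filter (fun j => (k, j) ∈ F) with hG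
        have hmk := hm k
        set J : ℝ := T / ((max 1 k : ℕ) : ℝ) ^ γ with hJ
        have hJ0 : 0 < J := by positivity
        have hj : ∀ j ∈ G, 1 ≤ j ∧ (j : ℝ) ≤ J := by
          intro j hj
          obtain ⟨h1, h2⟩ := hF _ (Finset.mem_filter.mp hj).2
          refine ⟨h1, ?_⟩
          rw [hJ, le_div_iff₀ (by positivity)]
          linarith
        have hcard : (G.card : ℝ) ≤ J := by
          have hsub : G ⊆ Finset.Icc 1 ⌊J⌋₊ := fun j h => by
            rw [Finset.mem_Icc]
            exact ⟨(hj j h).1, Nat.le_floor (hj j h).2⟩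
          have h1 := Finset.card_le_card hsub
          rw [Nat.card_Icc, Nat.add_sub_cancel] at h1
          exact (Nat.cast_le.mpr h1).trans (Nat.floor_le hJ0.le)
        have hsum : ∑ j ∈ G, |ξ (k, j)| ≤ J ^ (1 - (p⁻¹).toReal) * ‖ξ‖ := by
          have h := sum_abs_le_card_rpow_mul_norm hp ξ (G.image (fun j => (k, j)))
          have hinj : Function.Injective (fun j : ℕ => (k, j)) := fun i j h => by simpa using h
          rw [Finset.sum_image (fun _ _ _ _ h => hinj h), Finset.card_image_of_injective _ hinj] at h
          refine h.trans ?_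
          have : 0 ≤ 1 - (p⁻¹).toReal := by linarith
          gcongr
        calc _ ≤ ∑ j ∈ G, |ξ (k, j)| * (((max 1 k : ℕ) : ℝ) ^ (1 / 2 : ℝ) * J ^ β) := by
              refine Finset.sum_le_sum fun j h => ?_
              have := (hj j h).2
              gcongr
          _ ≤ (J ^ (1 - (p⁻¹).toReal) * ‖ξ‖) * (((max 1 k : ℕ) : ℝ) ^ (1 / 2 : ℝ) * J ^ β) := by
              rw [← Finset.sum_mul]
              gcongr
          _ = ‖ξ‖ * J ^ θ * ((max 1 k : ℕ) : ℝ) ^ (1 / 2 : ℝ) := by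
              rw [hθ, Real.rpow_add hJ0]; ring
          _ ≤ ‖ξ‖ * (T / ((max 1 k : ℕ) : ℝ)) ^ θ * ((max 1 k : ℕ) : ℝ) ^ (1 / 2 : ℝ) := by
              have : ((max 1 k : ℕ) : ℝ) ≤ ((max 1 k : ℕ) : ℝ) ^ γ := by
                conv_lhs => rw [← Real.rpow_one ((max 1 k : ℕ) : ℝ)]
                exact Real.rpow_le_rpow_of_exponent_le (hm1 k) hγ
              have : J ≤ T / ((max 1 k : ℕ) : ℝ) := by rw [hJ]; gcongr
              have h0 : 0 ≤ θ := by linarith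
              gcongr
          _ = _ := by
              rw [Real.div_rpow hT.le hmk.le, Real.rpow_sub hmk]
              ring
    _ = ‖ξ‖ * T ^ θ * ∑ k ∈ F.image Prod.fst, ((max 1 k : ℕ) : ℝ) ^ (1 / 2 - θ) := by
        rw [Finset.mul_sum]
    _ ≤ ‖ξ‖ * T ^ θ * ∑' k : ℕ, ((max 1 k : ℕ) : ℝ) ^ (1 / 2 - θ) := by
        refine mul_le_mul_of_nonneg_left ?_ (mul_nonneg hξ (by positivity))
        exact hsummable.sum_le_tsum _ (fun _ _ => by positivity)
    _ = _ := by ring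


theorem one_le_cast_max_one (k : ℕ) : (1 : ℝ) ≤ ((max 1 k : ℕ) : ℝ) := by simp

theorem mem_hyperbolicCross_iff {r n : ℕ} {γ : ℝ} (hr : 1 ≤ r) (hγ : 1 ≤ γ) (q : ℕ × ℕ) :
    q ∈ hyperbolicCross r n γ ↔ r ≤ q.2 ∧ ((max 1 q.1 : ℕ) : ℝ) ^ γ * q.2 ≤ n := by
  have hγ0 : 0 < γ := by linarith
  simp only [hyperbolicCross, Finset.mem_filter, Finset.mem_product, Finset.mem_range,
    Finset.mem_Icc]
  rcases Nat.eq_zero_or_pos q.1 with h0 | h0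
  · rw [h0]
    simp [Real.zero_rpow hγ0.ne']
    intro _ _
    positivity
  · have hmax : max 1 q.1 = q.1 := max_eq_right h0
    rw [hmax]
    have h1 : (1 : ℝ) ≤ q.1 := by exact_mod_cast h0
    constructor
    · rintro ⟨⟨_, h, _⟩, h', _⟩
      exact ⟨h, h'⟩
    · rintro ⟨h, h'⟩
      have h2 : (1 : ℝ) ≤ q.2 := by exact_mod_cast hr.trans h
      have hg : (q.1 : ℝ) ≤ (q.1 : ℝ) ^ γ := by
        conv_lhs => rw [← Real.rpow_one (q.1 : ℝ)]
        exact Real.rpow_le_rpow_of_exponent_le h1 hγ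
      have hg2 : (q.1 : ℝ) ^ γ ≤ n := by nlinarith
      have hg3 : (q.2 : ℝ) ≤ n := by nlinarith
      have hg4 : (q.1 : ℝ) ≤ n := by linarith
      refine ⟨⟨?_, h, by exact_mod_cast hg3⟩, h', ?_⟩
      · have : q.1 ≤ n := by exact_mod_cast hg4
        omega
      · rw [one_div, Real.le_rpow_inv_iff_of_pos (by positivity) (by positivity) hγ0]
        exact hg2

theorem sum_weightedTerm_le_one {s μ₁ μ₂ : ℝ} (hs : 1 ≤ s) {f : ℝ × ℝ → ℝ}
    (hf : f ∈ unitClass s μ₁ μ₂) (F : Finset (ℕ × ℕ)) : ∑ q ∈ F, weightedTerm s μ₁ μ₂ f q ≤ 1 := by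
  obtain ⟨_, h1, h2⟩ := hf
  refine (h1.sum_le_tsum F fun q _ => ?_).trans ?_
  · unfold weightedTerm; positivity
  · by_contra! h
    exact absurd h2 (not_le.mpr (Real.one_lt_rpow h (by positivity)))

section Bounds

variable {r : ℕ} {s μ₁ μ₂ κ γ : ℝ}

/-- Bound for the Fourier-Legendre coefficients outside a hyperbolic cross. -/
theorem sum_coeff_outside_le (hs : 1 ≤ s) (hκ : κ = μ₂ - 2 * (r : ℝ) + 1 / s - 3 / 2)
    (hκ0 : 0 < κ) (hγ : γ * κ < μ₁ + 1 / s - 3 / 2) :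
    ∃ C : ℝ, 0 < C ∧ ∀ f ∈ unitClass s μ₁ μ₂, ∀ (T : ℝ) (F : Finset (ℕ × ℕ)), 0 < T →
      (∀ q ∈ F, 1 ≤ q.2 ∧ T ≤ ((max 1 q.1 : ℕ) : ℝ) ^ γ * q.2) →
      ∑ q ∈ F, |coeff f q| * ‖derivBasis r q‖ ≤ C * T ^ (-κ) := by
  obtain ⟨C, hC, hsum⟩ := sum_outside_cross_le hs hκ0 hγ
  obtain ⟨D, hD, hnorm⟩ := norm_derivBasis_le r
  refine ⟨D * C, by positivity, fun f hf T F hT hF => ?_⟩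
  have hm : ∀ k : ℕ, (0 : ℝ) < ((max 1 k : ℕ) : ℝ) := fun k => by linarith [one_le_cast_max_one k]
  have h := hsum (fun q => ((max 1 q.1 : ℕ) : ℝ) ^ μ₁ * ((max 1 q.2 : ℕ) : ℝ) ^ μ₂ * |coeff f q|)
    T F hT (fun q => by positivity) hF (by
      refine le_trans (le_of_eq (Finset.sum_congr rfl fun q _ => ?_))
        (sum_weightedTerm_le_one hs hf F)
      have h1 := hm q.1
      have h2 := hm q.2
      rw [weightedTerm, Real.mul_rpow (by positivity) (abs_nonneg _),
        Real.mul_rpow (by positivity) (by positivity), ← Real.rpow_mul h1.le,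
        ← Real.rpow_mul h2.le, mul_comm μ₁, mul_comm μ₂])
  calc _ ≤ ∑ q ∈ F, D * ((fun q : ℕ × ℕ => ((max 1 q.1 : ℕ) : ℝ) ^ μ₁ *
        ((max 1 q.2 : ℕ) : ℝ) ^ μ₂ * |coeff f q|) q *
        (((max 1 q.1 : ℕ) : ℝ) ^ (-(μ₁ + 1 / s - 3 / 2) - (1 - 1 / s)) *
        (q.2 : ℝ) ^ (-κ - (1 - 1 / s)))) := by
        refine Finset.sum_le_sum fun q hq => ?_
        have h1 := hm q.1
        have h2 := hm q.2
        have h3 : (q.2 : ℝ) = ((max 1 q.2 : ℕ) : ℝ) := by rw [max_eq_right (hF q hq).1]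
        rw [h3, show -(μ₁ + 1 / s - 3 / 2) - (1 - 1 / s) = 1 / 2 - μ₁ by ring,
          show -κ - (1 - 1 / s) = (2 * (r : ℝ) + 1 / 2) - μ₂ by rw [hκ]; ring,
          Real.rpow_sub h1, Real.rpow_sub h2]
        calc _ ≤ |coeff f q| * (D * (((max 1 q.1 : ℕ) : ℝ) ^ (1 / 2 : ℝ) *
              ((max 1 q.2 : ℕ) : ℝ) ^ (2 * (r : ℝ) + 1 / 2))) := by
              gcongr
              exact hnorm q
          _ = _ := by
              simp only
              field_simp
    _ ≤ D * (C * T ^ (-κ)) := by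
        rw [← Finset.mul_sum]
        gcongr
    _ = _ := by ring

theorem summable_norm_derivTerm (hr : 1 ≤ r) (hs : 1 ≤ s)
    (hκ : κ = μ₂ - 2 * (r : ℝ) + 1 / s - 3 / 2) (hκ0 : 0 < κ)
    (hlam : κ < μ₁ + 1 / s - 3 / 2) {f : ℝ × ℝ → ℝ}
    (hf : f ∈ unitClass s μ₁ μ₂) : Summable (fun q => ‖derivTerm r f q‖) := by
  obtain ⟨C, hC, hsum⟩ := sum_coeff_outside_le (μ₁ := μ₁) (γ := 1) hs hκ hκ0 (by linarith)
  refine summable_of_sum_le (c := C * (1 : ℝ) ^ (-κ)) (fun q => norm_nonneg _) fun F => ?_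
  have h := hsum f hf 1 (F.map (Function.Embedding.subtype _)) one_pos (by
    intro q hq
    obtain ⟨a, _, rfl⟩ := Finset.mem_map.mp hq
    have h1 : 1 ≤ a.1.2 := hr.trans a.2
    have h2 : (1 : ℝ) ≤ a.1.2 := by exact_mod_cast h1
    refine ⟨h1, ?_⟩
    rw [Real.rpow_one]
    exact one_le_mul_of_one_le_of_one_le (one_le_cast_max_one _) h2)
  rw [Finset.sum_map] at h
  simpa [derivTerm, norm_smul] using h

/-- Upper bound for the error of the truncation method. -/
theorem truncError_le (hr : 1 ≤ r) (hs : 1 ≤ s) {p : ℝ≥0∞} (hp : 1 ≤ p)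
    (hκ : κ = μ₂ - 2 * (r : ℝ) + 1 / s - 3 / 2) (hκ0 : 0 < κ) (hγ1 : 1 ≤ γ)
    (hγ : γ * κ < μ₁ + 1 / s - 3 / 2) :
    ∃ C : ℝ, 0 < C ∧ ∀ (δ : ℝ) (n : ℕ), truncError r s μ₁ μ₂ p δ n γ ≤
      ENNReal.ofReal (C * (((max 1 n : ℕ) : ℝ) ^ (-κ) +
        δ * ((max 1 n : ℕ) : ℝ) ^ (2 * (r : ℝ) + 1 / 2 + (1 - (p⁻¹).toReal)))) := by
  have hlam : κ < μ₁ + 1 / s - 3 / 2 := by nlinarith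
  have hr' : (1 : ℝ) ≤ r := by exact_mod_cast hr
  obtain ⟨C, hC, htail⟩ := sum_coeff_outside_le (μ₁ := μ₁) (γ := γ) hs hκ hκ0 hγ
  obtain ⟨D, hD, hnorm⟩ := norm_derivBasis_le r
  obtain ⟨E, hE, hnoise⟩ := sum_inside_cross_le hp (β := 2 * (r : ℝ) + 1 / 2) (by linarith)
  set θ : ℝ := 2 * (r : ℝ) + 1 / 2 + (1 - (p⁻¹).toReal) with hθ
  refine ⟨C + D * E, by positivity, fun δ n => ?_⟩
  unfold truncError algError
  refine iSup₂_le fun f hf => iSup₂_le fun y hy => ENNReal.ofReal_le_ofReal ?_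
  obtain ⟨ξ, hξ, hξδ⟩ := hy
  set T : ℝ := ((max 1 n : ℕ) : ℝ) with hT
  have hT1 : 1 ≤ T := one_le_cast_max_one n
  have hT0 : 0 < T := by linarith
  have hnT : (n : ℝ) ≤ T := by simp [hT]
  set Γ := hyperbolicCross r n γ with hΓ
  have htrunc : truncation r n γ (fun q => y q.1) = ∑ q ∈ Γ, y q • derivBasis r q := by
    exact Finset.sum_coe_sort Γ (fun q => y q • derivBasis r q)
  have hsummable : Summable (derivTerm r f) :=
    (summable_norm_derivTerm hr hs hκ hκ0 hlam hf).of_norm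
  have hlim := (hsummable.hasSum.sub_const (truncation r n γ (fun q => y q.1))).norm
  refine le_of_tendsto hlim ?_
  filter_upwards [Filter.eventually_ge_atTop (Γ.subtype (fun q : ℕ × ℕ => r ≤ q.2))] with F hF
  set G : Finset (ℕ × ℕ) := F.map (Function.Embedding.subtype _) with hG
  have hGr : ∀ q ∈ G, r ≤ q.2 := by
    intro q hq
    obtain ⟨a, _, rfl⟩ := Finset.mem_map.mp hq
    exact a.2
  have hΓG : Γ ⊆ G := by
    intro q hq
    have hrq := ((mem_hyperbolicCross_iff hr hγ1 q).mp hq).1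
    exact Finset.mem_map.mpr ⟨⟨q, hrq⟩, hF (by simpa using hq), rfl⟩
  have hsumF : ∑ q ∈ F, derivTerm r f q = ∑ q ∈ G, coeff f q • derivBasis r q := by
    rw [hG, Finset.sum_map]; rfl
  have hdecomp : ∑ q ∈ F, derivTerm r f q - truncation r n γ (fun q => y q.1) =
      ∑ q ∈ G \ Γ, coeff f q • derivBasis r q + ∑ q ∈ Γ, ξ q • derivBasis r q := by
    rw [hsumF, htrunc, ← Finset.sum_sdiff hΓG, add_sub_assoc, ← Finset.sum_sub_distrib]
    congr 1
    refine Finset.sum_congr rfl fun q _ => ?_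
    rw [hξ, sub_smul]
  have h1 : ‖∑ q ∈ G \ Γ, coeff f q • derivBasis r q‖ ≤ C * T ^ (-κ) := by
    refine (norm_sum_le _ _).trans ?_
    simp_rw [norm_smul, Real.norm_eq_abs]
    refine htail f hf T _ hT0 fun q hq => ?_
    obtain ⟨hqG, hqΓ⟩ := Finset.mem_sdiff.mp hq
    have hrq := hGr q hqG
    have hq1 : 1 ≤ q.2 := hr.trans hrq
    have hq1' : (1 : ℝ) ≤ q.2 := by exact_mod_cast hq1
    refine ⟨hq1, ?_⟩
    rw [mem_hyperbolicCross_iff hr hγ1, not_and, not_le] at hqΓ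
    have h2 := hqΓ hrq
    have h3 : (1 : ℝ) ≤ ((max 1 q.1 : ℕ) : ℝ) ^ γ * q.2 :=
      one_le_mul_of_one_le_of_one_le
        (Real.one_le_rpow (one_le_cast_max_one _) (by linarith)) hq1'
    rw [hT, Nat.cast_max, Nat.cast_one]
    exact max_le h3 h2.le
  have h2 : ‖∑ q ∈ Γ, ξ q • derivBasis r q‖ ≤ D * (E * (δ * T ^ θ)) := by
    refine (norm_sum_le _ _).trans ?_
    simp_rw [norm_smul, Real.norm_eq_abs]
    have h := hnoise ξ γ T Γ hγ1 hT0 fun q hq => by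
      obtain ⟨ha, hb⟩ := (mem_hyperbolicCross_iff hr hγ1 q).mp hq
      exact ⟨hr.trans ha, hb.trans hnT⟩
    calc _ ≤ ∑ q ∈ Γ, D * (|ξ q| * (((max 1 q.1 : ℕ) : ℝ) ^ (1 / 2 : ℝ) *
          (q.2 : ℝ) ^ (2 * (r : ℝ) + 1 / 2))) := by
          refine Finset.sum_le_sum fun q hq => ?_
          have hq1 := hr.trans ((mem_hyperbolicCross_iff hr hγ1 q).mp hq).1
          have h3 : (q.2 : ℝ) = ((max 1 q.2 : ℕ) : ℝ) := by rw [max_eq_right hq1]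
          rw [h3]
          refine (mul_le_mul_of_nonneg_left (hnorm q) (abs_nonneg _)).trans (le_of_eq ?_)
          ring
      _ ≤ D * (E * (‖ξ‖ * T ^ θ)) := by
          rw [← Finset.mul_sum]
          gcongr
      _ ≤ _ := by gcongr
  rw [hdecomp]
  refine (norm_add_le _ _).trans ((add_le_add h1 h2).trans ?_)
  have hδ : 0 ≤ δ := (lp.norm_nonneg' ξ).trans hξδ
  have h3 : 0 ≤ T ^ (-κ) := by positivity
  have h4 : 0 ≤ δ * T ^ θ := by positivity
  nlinarith [mul_nonneg (mul_nonneg hD.le hE.le) h3, mul_nonneg hC.le h4]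

end Bounds

theorem partialDeriv_eq_sum {r : ℕ} {f : ℝ × ℝ → ℝ} {S : Finset (ℕ × ℕ)} (hS : ∀ q ∈ S, r ≤ q.2)
    (hf : ∀ q ∉ S, coeff f q = 0) :
    partialDeriv r f = ∑ q ∈ S, coeff f q • derivBasis r q := by
  rw [partialDeriv, tsum_eq_sum (s := S.subtype (fun q : ℕ × ℕ => r ≤ q.2))]
  · rw [← Finset.sum_subtype_of_mem (fun q => coeff f q • derivBasis r q) hS]
    rfl
  · intro q hq
    rw [derivTerm, hf _ (by simpa using hq), zero_smul]

theorem isPerturbation_self {p : ℝ≥0∞} {δ : ℝ} (hδ : 0 ≤ δ) (x : ℕ × ℕ → ℝ) :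
    IsPerturbation p δ x x :=
  ⟨0, fun q => by simp, by simpa using hδ⟩

/-- The information radius is bounded below by the derivatives of functions of the class with
vanishing information. -/
theorem le_algError {r : ℕ} {s μ₁ μ₂ : ℝ} {p : ℝ≥0∞} {δ : ℝ} (hδ : 0 ≤ δ) {Ω : Finset (ℕ × ℕ)}
    (ψ : (Ω → ℝ) → C(square, ℝ)) {f g : ℝ × ℝ → ℝ} (hf : f ∈ unitClass s μ₁ μ₂)
    (hg : g ∈ unitClass s μ₁ μ₂) (hfg : ∀ q, coeff g q = -coeff f q)
    (hΩ : ∀ q ∈ Ω, coeff f q = 0) :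
    ENNReal.ofReal ‖partialDeriv r f‖ ≤ algError r s μ₁ μ₂ p δ Ω ψ := by
  have key : ∀ h ∈ unitClass s μ₁ μ₂, (∀ q ∈ Ω, coeff h q = 0) →
      ENNReal.ofReal ‖partialDeriv r h - ψ (fun _ => 0)‖ ≤ algError r s μ₁ μ₂ p δ Ω ψ := by
    intro h hh hz
    have heq : (fun q : Ω => coeff h q.1) = fun _ => 0 := funext fun q => hz q.1 q.2
    rw [← heq]
    exact le_iSup₂_of_le h hh
      (le_iSup₂_of_le (coeff h) (isPerturbation_self hδ (coeff h)) le_rfl)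
  have hneg : partialDeriv r g = -partialDeriv r f := by
    rw [partialDeriv, partialDeriv, ← tsum_neg]
    refine tsum_congr fun q => ?_
    rw [derivTerm, derivTerm, hfg, neg_smul]
  have h1 := key f hf hΩ
  have h2 := key g hg fun q hq => by rw [hfg, hΩ q hq, neg_zero]
  set u := partialDeriv r f
  set v := ψ (fun _ => 0)
  rw [hneg] at h2
  have h3 : ‖u‖ ≤ max ‖u - v‖ ‖-u - v‖ := by
    have h4 : ‖(u - v) - (-u - v)‖ ≤ ‖u - v‖ + ‖-u - v‖ := norm_sub_le _ _
    have h5 : (u - v) - (-u - v) = (2 : ℝ) • u := by rw [two_smul]; abel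
    rw [h5, norm_smul, Real.norm_eq_abs, abs_two] at h4
    rcases le_total ‖u - v‖ ‖-u - v‖ with h6 | h6
    · exact le_max_of_le_right (by linarith)
    · exact le_max_of_le_left (by linarith)
  rcases le_max_iff.mp h3 with h | h
  · exact (ENNReal.ofReal_le_ofReal h).trans h1
  · exact (ENNReal.ofReal_le_ofReal h).trans h2

theorem exists_mem_unitClass {s μ₁ μ₂ : ℝ} (hs : 1 ≤ s) (J : Finset ℕ) {B : ℝ}
    (hB : ∑ j ∈ J, ((max 1 j : ℕ) : ℝ) ^ (s * μ₂) * |B| ^ s ≤ 1) :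
    ∃ f ∈ unitClass s μ₁ μ₂, ∀ q, coeff f q = if q ∈ J.image (fun j => (0, j)) then B else 0 := by
  set S := J.image (fun j => ((0 : ℕ), j)) with hS
  obtain ⟨f, hf, hc⟩ := exists_coeff_eq S fun _ => B
  have hz : ∀ q ∉ S, weightedTerm s μ₁ μ₂ f q = 0 := by
    intro q hq
    rw [weightedTerm, hc, if_neg hq, abs_zero, Real.zero_rpow (by linarith), mul_zero]
  refine ⟨f, ⟨hf, summable_of_ne_finset_zero hz, ?_⟩, hc⟩
  rw [tsum_eq_sum hz]
  refine Real.rpow_le_one (Finset.sum_nonneg fun q _ => ?_) ?_ (by positivity)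
  · unfold weightedTerm; positivity
  · refine le_trans (le_of_eq ?_) hB
    rw [hS, Finset.sum_image (fun a _ b _ h => by simpa using h)]
    refine Finset.sum_congr rfl fun j hj => ?_
    rw [weightedTerm, hc, if_pos (Finset.mem_image_of_mem _ hj)]
    simp

/-- Lower bound for the minimal radius of Galerkin information. -/
theorem exists_le_minRadius {r : ℕ} (hr : 1 ≤ r) {s μ₁ μ₂ κ : ℝ} (hs : 1 ≤ s) (p : ℝ≥0∞)
    (hμ₂ : 0 < μ₂) (hκ : κ = μ₂ - 2 * (r : ℝ) + 1 / s - 3 / 2) :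
    ∃ c : ℝ, 0 < c ∧ ∀ (δ : ℝ) (N : ℕ), 0 ≤ δ → 1 ≤ N →
      ENNReal.ofReal (c * (N : ℝ) ^ (-κ)) ≤ minRadius r s μ₁ μ₂ p N δ := by
  set c₀ : ℝ := ((4 * (r + 1 : ℝ)) ^ r)⁻¹ with hc₀
  have hc₀' : 0 < c₀ := by positivity
  set K : ℝ := (2 * r + 2 : ℝ) ^ (-μ₂) * 2 ^ (-(1 / s)) * √(1 / 2) * c₀ with hK
  refine ⟨K, by positivity, fun δ N hδ hN => ?_⟩
  have hN0 : (0 : ℝ) < N := by exact_mod_cast hN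
  refine le_iInf fun Ω => le_iInf fun hΩ => le_iInf fun ψ => ?_
  obtain ⟨hΩr, hΩN⟩ := hΩ
  set J : Finset ℕ := Finset.Ico (2 * r * N) (2 * r * N + 2 * N) \ Ω.image Prod.snd with hJ
  have hJcard : N ≤ J.card := by
    have h1 : (Finset.Ico (2 * r * N) (2 * r * N + 2 * N)).card - (Ω.image Prod.snd).card ≤
        J.card := Finset.le_card_sdiff _ _
    have h2 : (Ω.image Prod.snd).card ≤ Ω.card := Finset.card_image_le
    rw [Nat.card_Ico] at h1
    omega
  have hJcard2 : J.card ≤ 2 * N := by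
    refine (Finset.card_le_card Finset.sdiff_subset).trans ?_
    rw [Nat.card_Ico]; omega
  have hJmem : ∀ j ∈ J, N ≤ j ∧ 2 * r ≤ j ∧ r ≤ j ∧ j ≤ (2 * r + 2) * N := by
    intro j hj
    have h := Finset.mem_Ico.mp (Finset.mem_sdiff.mp hj).1
    have h1 : 2 * r ≤ 2 * r * N := Nat.le_mul_of_pos_right _ hN
    have h2 : N ≤ 2 * r * N := Nat.le_mul_of_pos_left _ (by omega)
    refine ⟨by omega, by omega, by omega, ?_⟩
    rw [add_mul]; omega
  set M : ℝ := (2 * r + 2 : ℝ) * N with hM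
  have hM0 : 0 < M := by positivity
  set B : ℝ := M ^ (-μ₂) * (2 * N : ℝ) ^ (-(1 / s)) with hB
  have hB0 : 0 < B := by positivity
  have hsum : ∑ j ∈ J, ((max 1 j : ℕ) : ℝ) ^ (s * μ₂) * |B| ^ s ≤ 1 := by
    have hs0 : 0 < s := by linarith
    calc _ ≤ ∑ j ∈ J, (2 * N : ℝ)⁻¹ := by
          refine Finset.sum_le_sum fun j hj => ?_
          obtain ⟨h1, _, _, h2⟩ := hJmem j hj
          rw [max_eq_right (hN.trans h1)]
          have h3 : (j : ℝ) ≤ M := by rw [hM]; exact_mod_cast h2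
          calc _ ≤ M ^ (s * μ₂) * |B| ^ s := by gcongr
            _ = _ := by
              rw [abs_of_pos hB0, hB, Real.mul_rpow (x := M ^ (-μ₂)) (by positivity) (by positivity),
                ← Real.rpow_mul hM0.le, ← Real.rpow_mul (by positivity), ← mul_assoc,
                ← Real.rpow_add hM0, show s * μ₂ + -μ₂ * s = 0 by ring,
                show -(1 / s) * s = -1 by field_simp, Real.rpow_zero, one_mul, Real.rpow_neg_one]
      _ = J.card * (2 * N : ℝ)⁻¹ := by rw [Finset.sum_const, nsmul_eq_mul]
      _ ≤ (2 * N : ℝ) * (2 * N : ℝ)⁻¹ := by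
          gcongr
          exact_mod_cast hJcard2
      _ = 1 := mul_inv_cancel₀ (by positivity)
  obtain ⟨f, hf, hcf⟩ := exists_mem_unitClass (μ₁ := μ₁) hs J hsum
  obtain ⟨g, hg, hcg⟩ := exists_mem_unitClass (μ₁ := μ₁) hs J (B := -B) (by rwa [abs_neg])
  refine le_trans (ENNReal.ofReal_le_ofReal ?_) (le_algError hδ ψ hf hg ?_ ?_)
  · have hpd := partialDeriv_eq_sum (r := r) (f := f) (S := J.image (fun j => ((0 : ℕ), j)))
      (by
        intro q hq
        obtain ⟨j, hj, rfl⟩ := Finset.mem_image.mp hq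
        exact (hJmem j hj).2.2.1)
      (fun q hq => by rw [hcf, if_neg hq])
    have h11 : ((1 : ℝ), (1 : ℝ)) ∈ square := ⟨by norm_num, by norm_num⟩
    have hval : partialDeriv r f ⟨(1, 1), h11⟩ =
        ∑ j ∈ J, B * (√(1 / 2) * (Polynomial.derivative^[r] (legendre j)).eval 1) := by
      rw [hpd, Finset.sum_image (fun a _ b _ h => by simpa using h), ContinuousMap.sum_apply]
      refine Finset.sum_congr rfl fun j hj => ?_
      rw [hcf, if_pos (Finset.mem_image_of_mem _ hj)]
      change B * ((legendre 0).eval 1 * (Polynomial.derivative^[r] (legendre j)).eval 1) = _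
      rw [eval_one_legendre]
      simp
    refine le_trans ?_ (ContinuousMap.norm_coe_le_norm (partialDeriv r f) ⟨(1, 1), h11⟩)
    rw [hval]
    refine le_trans ?_ (le_abs_self _)
    calc K * (N : ℝ) ^ (-κ)
        = (N : ℝ) * (B * (√(1 / 2) * (c₀ * (N : ℝ) ^ (2 * (r : ℝ) + 1 / 2)))) := by
          have h1 : (N : ℝ) ^ (-κ) = (N : ℝ) ^ (1 : ℝ) * (N : ℝ) ^ (-μ₂) * (N : ℝ) ^ (-(1 / s)) *
              (N : ℝ) ^ (2 * (r : ℝ) + 1 / 2) := by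
            rw [← Real.rpow_add hN0, ← Real.rpow_add hN0, ← Real.rpow_add hN0, hκ]
            congr 1; ring
          rw [h1, hB, hM, hK, Real.mul_rpow (by positivity) hN0.le,
            Real.mul_rpow (by positivity) hN0.le, Real.rpow_one]
          ring
      _ ≤ J.card * (B * (√(1 / 2) * (c₀ * (N : ℝ) ^ (2 * (r : ℝ) + 1 / 2)))) := by
          gcongr
      _ = ∑ j ∈ J, (B * (√(1 / 2) * (c₀ * (N : ℝ) ^ (2 * (r : ℝ) + 1 / 2)))) := by
          rw [Finset.sum_const, nsmul_eq_mul]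
      _ ≤ _ := by
          refine Finset.sum_le_sum fun j hj => ?_
          obtain ⟨h1, h2, _, _⟩ := hJmem j hj
          have h3 := le_eval_one_iterate_derivative_legendre r j (hN.trans h1) h2
          have h4 : c₀ * (N : ℝ) ^ (2 * (r : ℝ) + 1 / 2) ≤ c₀ * (j : ℝ) ^ (2 * (r : ℝ) + 1 / 2) := by
            gcongr
          gcongr
          exact h4.trans h3
  · intro q
    rw [hcf, hcg]
    split_ifs <;> simp
  · intro q hq
    rw [hcf, if_neg]
    intro h
    obtain ⟨j, hj, rfl⟩ := Finset.mem_image.mp h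
    exact (Finset.mem_sdiff.mp hj).2 (Finset.mem_image_of_mem Prod.snd hq)

theorem card_hyperbolicCross_le {r : ℕ} (hr : 1 ≤ r) (n : ℕ) {γ : ℝ} (hγ : 1 ≤ γ) :
    ((hyperbolicCross r n γ).card : ℝ) ≤
      n * ∑ k ∈ Finset.range (n + 1), ((max 1 k : ℕ) : ℝ) ^ (-γ) := by
  have hmaps : Set.MapsTo Prod.fst (hyperbolicCross r n γ : Set (ℕ × ℕ))
      (Finset.range (n + 1) : Set ℕ) := by
    intro q hq
    have := (Finset.mem_filter.mp hq).1
    exact (Finset.mem_product.mp this).1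
  rw [Finset.card_eq_sum_card_fiberwise hmaps, Nat.cast_sum, Finset.mul_sum]
  refine Finset.sum_le_sum fun k _ => ?_
  have hk : (0 : ℝ) < ((max 1 k : ℕ) : ℝ) := by linarith [one_le_cast_max_one k]
  rw [Real.rpow_neg hk.le, ← div_eq_mul_inv]
  set J : ℝ := n / ((max 1 k : ℕ) : ℝ) ^ γ with hJ
  have hJ0 : 0 ≤ J := by positivity
  have h : ((hyperbolicCross r n γ).filter (fun q => q.1 = k)).card ≤ (Finset.Icc 1 ⌊J⌋₊).card := by
    refine Finset.card_le_card_of_injOn Prod.snd ?_ ?_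
    · intro q hq
      obtain ⟨h1, rfl⟩ := Finset.mem_filter.mp hq
      obtain ⟨h2, h3⟩ := (mem_hyperbolicCross_iff hr hγ q).mp h1
      rw [Finset.mem_coe, Finset.mem_Icc]
      refine ⟨hr.trans h2, Nat.le_floor ?_⟩
      rw [hJ, le_div_iff₀ (by positivity)]
      linarith
    · intro a ha b hb hab
      have h1 := (Finset.mem_filter.mp ha).2
      have h2 := (Finset.mem_filter.mp hb).2
      exact Prod.ext (h1.trans h2.symm) hab
  rw [Nat.card_Icc, Nat.add_sub_cancel] at h
  exact (Nat.cast_le.mpr h).trans (Nat.floor_le hJ0)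

theorem exists_card_hyperbolicCross_le {r : ℕ} (hr : 1 ≤ r) {γ : ℝ} (hγ : 1 < γ) :
    ∃ C : ℝ, 0 < C ∧ ∀ n : ℕ, ((hyperbolicCross r n γ).card : ℝ) ≤ C * n := by
  have hsummable := summable_max_one_rpow (a := -γ) (by linarith)
  refine ⟨∑' k : ℕ, ((max 1 k : ℕ) : ℝ) ^ (-γ),
    hsummable.tsum_pos (fun k => by positivity) 0 (by simp), fun n => ?_⟩
  refine (card_hyperbolicCross_le hr n hγ.le).trans ?_
  rw [mul_comm]
  gcongr
  exact hsummable.sum_le_tsum _ (fun _ _ => by positivity)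

theorem card_hyperbolicCross_one_le {r : ℕ} (hr : 1 ≤ r) (n : ℕ) :
    ((hyperbolicCross r n 1).card : ℝ) ≤ n * (2 + Real.log n) := by
  refine (card_hyperbolicCross_le hr n le_rfl).trans ?_
  gcongr
  rw [Finset.sum_range_succ']
  have h := harmonic_le_one_add_log n
  have h2 : ∑ k ∈ Finset.range n, ((max 1 (k + 1) : ℕ) : ℝ) ^ (-1 : ℝ) = (harmonic n : ℝ) := by
    simp only [harmonic, Rat.cast_sum]
    refine Finset.sum_congr rfl fun k _ => ?_
    rw [Real.rpow_neg_one, max_eq_right (by omega)]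
    simp
  rw [h2]
  simp
  linarith

theorem le_card_hyperbolicCross {r n : ℕ} (hr : 1 ≤ r) (hn : r ≤ n) {γ : ℝ} (hγ : 1 ≤ γ) :
    (n : ℝ) / r ≤ (hyperbolicCross r n γ).card := by
  have h : (Finset.Icc r n).card ≤ (hyperbolicCross r n γ).card := by
    refine Finset.card_le_card_of_injOn (fun j => ((0 : ℕ), j)) ?_ (fun a _ b _ h => by simpa using h)
    intro j hj
    obtain ⟨h1, h2⟩ := Finset.mem_Icc.mp hj
    rw [Finset.mem_coe, mem_hyperbolicCross_iff hr hγ]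
    exact ⟨h1, by simpa using h2⟩
  rw [Nat.card_Icc] at h
  have h1 : ((n + 1 - r : ℕ) : ℝ) ≤ (hyperbolicCross r n γ).card := by exact_mod_cast h
  rw [Nat.cast_sub (by omega)] at h1
  push_cast at h1
  have hr' : (1 : ℝ) ≤ r := by exact_mod_cast hr
  have hn' : (r : ℝ) ≤ n := by exact_mod_cast hn
  refine le_trans ?_ h1
  rw [div_le_iff₀ (by linarith)]
  nlinarith

theorem le_card_hyperbolicCross_one {r n : ℕ} (hr : 1 ≤ r) (hn : 2 * r ≤ n) :
    (n : ℝ) / 2 * Real.log (n / (2 * r)) ≤ (hyperbolicCross r n 1).card := by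
  set K := n / (2 * r) with hK
  have h : ((Finset.range K).sigma (fun k => Finset.Icc r (n / (k + 1)))).card ≤
      (hyperbolicCross r n 1).card := by
    refine Finset.card_le_card_of_injOn (fun x => (x.1 + 1, x.2)) ?_ ?_
    · rintro ⟨k, j⟩ hx
      obtain ⟨_, hj⟩ := Finset.mem_sigma.mp hx
      obtain ⟨h1, h2⟩ := Finset.mem_Icc.mp hj
      rw [Finset.mem_coe, mem_hyperbolicCross_iff hr le_rfl]
      refine ⟨h1, ?_⟩
      have h3 : j * (k + 1) ≤ n := (Nat.le_div_iff_mul_le (Nat.succ_pos k)).mp h2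
      change ((max 1 (k + 1) : ℕ) : ℝ) ^ (1 : ℝ) * (j : ℝ) ≤ n
      rw [Real.rpow_one, max_eq_right (by omega)]
      rw [mul_comm] at h3
      exact_mod_cast h3
    · rintro ⟨k, j⟩ _ ⟨k', j'⟩ _ h
      simpa using h
  rw [Finset.card_sigma] at h
  have hr0 : (0 : ℝ) < r := by exact_mod_cast hr
  have hn0 : 0 < n := by omega
  have hn0' : (0 : ℝ) < n := by exact_mod_cast hn0
  calc (n : ℝ) / 2 * Real.log (n / (2 * r)) ≤ (n : ℝ) / 2 * Real.log ((K + 1 : ℕ) : ℝ) := by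
        gcongr
        have := Nat.lt_floor_add_one ((n : ℝ) / ((2 * r : ℕ) : ℝ))
        rw [Nat.floor_div_eq_div] at this
        push_cast at this ⊢
        exact this.le
    _ ≤ (n : ℝ) / 2 * (harmonic K : ℝ) := by
        gcongr
        exact log_add_one_le_harmonic K
    _ = ∑ k ∈ Finset.range K, (n : ℝ) / 2 * ((k : ℝ) + 1)⁻¹ := by
        simp only [harmonic, Rat.cast_sum, Finset.mul_sum]
        simp
    _ ≤ ∑ k ∈ Finset.range K, (((Finset.Icc r (n / (k + 1))).card : ℕ) : ℝ) := by
        refine Finset.sum_le_sum fun k hk => ?_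
        have hkK : k + 1 ≤ K := Finset.mem_range.mp hk
        have h1 : (k + 1) * (2 * r) ≤ n := (Nat.le_div_iff_mul_le (by omega)).mp hkK
        have h1' : ((k : ℝ) + 1) * (2 * r) ≤ n := by exact_mod_cast h1
        have h2 := Nat.lt_floor_add_one ((n : ℝ) / ((k + 1 : ℕ) : ℝ))
        rw [Nat.floor_div_eq_div] at h2
        push_cast at h2
        rw [Nat.card_Icc]
        have h3 : n / (k + 1) + 1 ≤ (n / (k + 1) + 1 - r) + r := by omega
        have h4 : ((n / (k + 1) : ℕ) : ℝ) + 1 ≤ ((n / (k + 1) + 1 - r : ℕ) : ℝ) + r := by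
          exact_mod_cast h3
        have h5 : (r : ℝ) ≤ n / 2 * ((k : ℝ) + 1)⁻¹ := by
          rw [← div_eq_mul_inv, le_div_iff₀ (by positivity)]
          linarith
        have h6 : (n : ℝ) / (k + 1) = n / 2 * ((k : ℝ) + 1)⁻¹ + n / 2 * ((k : ℝ) + 1)⁻¹ := by
          rw [div_eq_mul_inv]; ring
        linarith
    _ ≤ _ := by exact_mod_cast h


theorem rpow_neg_le_of_mul_le {c x y κ : ℝ} (hc : 0 < c) (hx : 0 < x) (hκ : 0 ≤ κ) (h : c * x ≤ y) :
    y ^ (-κ) ≤ c ^ (-κ) * x ^ (-κ) := by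
  rw [← Real.mul_rpow hc.le hx.le]
  exact Real.rpow_le_rpow_of_nonpos (by positivity) h (by linarith)

theorem le_rpow_neg_of_le_mul {c x y κ : ℝ} (hc : 0 < c) (hx : 0 < x) (hy : 0 < y) (hκ : 0 ≤ κ)
    (h : y ≤ c * x) : c ^ (-κ) * x ^ (-κ) ≤ y ^ (-κ) := by
  rw [← Real.mul_rpow hc.le hx.le]
  exact Real.rpow_le_rpow_of_nonpos hy h (by linarith)

theorem rpow_neg_le_of_le_mul {c x y κ : ℝ} (hc : 0 < c) (hx : 0 < x) (hy : 0 < y) (hκ : 0 ≤ κ)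
    (h : y ≤ c * x) : x ^ (-κ) ≤ c ^ κ * y ^ (-κ) := by
  have h1 := mul_le_mul_of_nonneg_left (le_rpow_neg_of_le_mul hc hx hy hκ h)
    (Real.rpow_nonneg hc.le κ)
  rwa [← mul_assoc, ← Real.rpow_add hc, add_neg_cancel, Real.rpow_zero, one_mul] at h1

theorem le_rpow_neg_of_mul_le {c x y κ : ℝ} (hc : 0 < c) (hx : 0 < x) (hκ : 0 ≤ κ)
    (h : c * x ≤ y) : c ^ κ * y ^ (-κ) ≤ x ^ (-κ) := by
  have h1 := mul_le_mul_of_nonneg_left (rpow_neg_le_of_mul_le hc hx hκ h)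
    (Real.rpow_nonneg hc.le κ)
  rwa [← mul_assoc, ← Real.rpow_add hc, add_neg_cancel, Real.rpow_zero, one_mul] at h1

theorem comparable_of_two_sided {c₁ c₂ A B e₁ e₂ κ : ℝ} (hc₁ : 0 < c₁) (hc₂ : 0 < c₂) (hA : 0 < A)
    (hB : 0 < B) (he₁ : 0 < e₁) (hκ : 0 ≤ κ) :
    ∃ C₁ C₂ : ℝ, 0 < C₁ ∧ 0 < C₂ ∧ C₁ ≤ e₁ ∧ e₂ ≤ C₂ ∧
      ∀ (x N : ℝ) (E : ℝ≥0∞), 0 < x → Comparable c₁ c₂ x N →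
        ENNReal.ofReal (A * x ^ (-κ)) ≤ E → E ≤ ENNReal.ofReal (B * x ^ (-κ)) →
        ComparableE C₁ C₂ (N ^ (-κ)) E ∧ ComparableE C₁ C₂ (x ^ (-κ)) E ∧
          Comparable C₁ C₂ (x ^ (-κ)) (N ^ (-κ)) := by
  refine ⟨min e₁ (min A (min (A * c₁ ^ κ) (c₂ ^ (-κ)))),
    max e₂ (max B (max (B * c₂ ^ κ) (c₁ ^ (-κ)))), by positivity,
    lt_of_lt_of_le hB (le_max_of_le_right (le_max_left _ _)), min_le_left _ _, le_max_left _ _,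
    fun x N E hx hN h1 h2 => ?_⟩
  obtain ⟨hN1, hN2⟩ := hN
  have hN0 : 0 < N := lt_of_lt_of_le (by positivity) hN1
  set C₁ := min e₁ (min A (min (A * c₁ ^ κ) (c₂ ^ (-κ)))) with hC₁
  set C₂ := max e₂ (max B (max (B * c₂ ^ κ) (c₁ ^ (-κ)))) with hC₂
  have hC1 : C₁ ≤ A := (min_le_right _ _).trans (min_le_left _ _)
  have hC2 : C₁ ≤ A * c₁ ^ κ :=
    (min_le_right _ _).trans ((min_le_right _ _).trans (min_le_left _ _))
  have hC3 : C₁ ≤ c₂ ^ (-κ) :=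
    (min_le_right _ _).trans ((min_le_right _ _).trans (min_le_right _ _))
  have hD1 : B ≤ C₂ := le_max_of_le_right (le_max_left _ _)
  have hD2 : B * c₂ ^ κ ≤ C₂ := le_max_of_le_right (le_max_of_le_right (le_max_left _ _))
  have hD3 : c₁ ^ (-κ) ≤ C₂ := le_max_of_le_right (le_max_of_le_right (le_max_right _ _))
  have hxκ : 0 < x ^ (-κ) := by positivity
  have hNκ : 0 < N ^ (-κ) := by positivity
  refine ⟨⟨le_trans (ENNReal.ofReal_le_ofReal ?_) h1, h2.trans (ENNReal.ofReal_le_ofReal ?_)⟩,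
    ⟨le_trans (ENNReal.ofReal_le_ofReal ?_) h1, h2.trans (ENNReal.ofReal_le_ofReal ?_)⟩, ?_, ?_⟩
  · calc _ ≤ A * c₁ ^ κ * N ^ (-κ) := by gcongr
      _ = A * (c₁ ^ κ * N ^ (-κ)) := by ring
      _ ≤ _ := by
        gcongr
        exact le_rpow_neg_of_mul_le hc₁ hx hκ hN1
  · calc _ ≤ B * (c₂ ^ κ * N ^ (-κ)) := by
          gcongr
          exact rpow_neg_le_of_le_mul hc₂ hx hN0 hκ hN2
      _ = B * c₂ ^ κ * N ^ (-κ) := by ring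
      _ ≤ _ := by gcongr
  · gcongr
  · gcongr
  · exact le_trans (by gcongr) (le_rpow_neg_of_le_mul hc₂ hx hN0 hκ hN2)
  · exact (rpow_neg_le_of_mul_le hc₁ hx hκ hN1).trans (by gcongr)

theorem minRadius_le_truncError {r : ℕ} (hr : 1 ≤ r) {s μ₁ μ₂ : ℝ} {p : ℝ≥0∞} {N n : ℕ} {δ γ : ℝ}
    (hγ : 1 ≤ γ) (hcard : ((hyperbolicCross r n γ).card : ℝ) ≤ N) :
    minRadius r s μ₁ μ₂ p N δ ≤ truncError r s μ₁ μ₂ p δ n γ := by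
  refine iInf₂_le_of_le (hyperbolicCross r n γ)
    ⟨fun q hq => ((mem_hyperbolicCross_iff hr hγ q).mp hq).1, by exact_mod_cast hcard⟩ ?_
  exact iInf_le _ (truncation r n γ)

theorem max_one_floor_mul {ε x : ℝ} (hε : 0 < ε) (hx : 1 ≤ x) :
    ε / 2 * x ≤ ((max 1 ⌊ε * x⌋₊ : ℕ) : ℝ) ∧ ((max 1 ⌊ε * x⌋₊ : ℕ) : ℝ) ≤ max 1 ε * x := by
  have h1 := Nat.lt_floor_add_one (ε * x)
  have h2 := Nat.floor_le (show 0 ≤ ε * x by positivity)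
  rw [Nat.cast_max, Nat.cast_one]
  constructor
  · have h3 := le_max_left (1 : ℝ) (⌊ε * x⌋₊ : ℝ)
    have h4 := le_max_right (1 : ℝ) (⌊ε * x⌋₊ : ℝ)
    linarith
  · have h3 := le_max_left 1 ε
    have h4 := le_max_right 1 ε
    refine max_le (by nlinarith) (h2.trans (by gcongr))

section Rate

variable {r : ℕ} {s μ₁ μ₂ κ d γ : ℝ}

/-- The truncation method has error of the order `x^{-κ}` if `δ = x^{-d}` and `n ≍ x`. -/
theorem truncError_le_rate (hr : 1 ≤ r) (hs : 1 ≤ s) {p : ℝ≥0∞} (hp : 1 ≤ p)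
    (hκ : κ = μ₂ - 2 * (r : ℝ) + 1 / s - 3 / 2) (hκ0 : 0 < κ)
    (hd : d = μ₂ - (p⁻¹).toReal + 1 / s) (hγ1 : 1 ≤ γ)
    (hγ : γ * κ < μ₁ + 1 / s - 3 / 2) {c₁ c₂ : ℝ} (hc₁ : 0 < c₁) (hc₂ : 0 < c₂) :
    ∃ C : ℝ, 0 < C ∧ ∀ (x δ : ℝ) (n : ℕ), 0 < x → δ = x ^ (-d) →
      c₁ * x ≤ ((max 1 n : ℕ) : ℝ) → ((max 1 n : ℕ) : ℝ) ≤ c₂ * x →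
      truncError r s μ₁ μ₂ p δ n γ ≤ ENNReal.ofReal (C * x ^ (-κ)) := by
  obtain ⟨C, hC, h⟩ := truncError_le (μ₁ := μ₁) hr hs hp hκ hκ0 hγ1 hγ
  set θ : ℝ := 2 * (r : ℝ) + 1 / 2 + (1 - (p⁻¹).toReal) with hθ
  have hp1 : (p⁻¹).toReal ≤ 1 := by
    rw [← ENNReal.toReal_one]
    exact ENNReal.toReal_mono ENNReal.one_ne_top (ENNReal.inv_le_one.mpr hp)
  have hθ0 : 0 ≤ θ := by
    have : (0 : ℝ) ≤ r := by positivity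
    linarith
  refine ⟨C * (c₁ ^ (-κ) + c₂ ^ θ), by positivity, fun x δ n hx hδ h1 h2 => ?_⟩
  refine (h δ n).trans (ENNReal.ofReal_le_ofReal ?_)
  rw [mul_assoc]
  refine mul_le_mul_of_nonneg_left ?_ hC.le
  rw [add_mul]
  refine add_le_add (rpow_neg_le_of_mul_le hc₁ hx hκ0.le h1) ?_
  calc _ ≤ x ^ (-d) * (c₂ * x) ^ θ := by
        rw [hδ]; gcongr
    _ = c₂ ^ θ * (x ^ (-d) * x ^ θ) := by
        rw [Real.mul_rpow hc₂.le hx.le]; ring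
    _ = _ := by
        rw [← Real.rpow_add hx]
        congr 2
        rw [hd, hθ, hκ]; ring

/-- Upper bound for the minimal radius, part a). -/
theorem exists_minRadius_le (hr : 1 ≤ r) (hs : 1 ≤ s) {p : ℝ≥0∞} (hp : 1 ≤ p)
    (hκ : κ = μ₂ - 2 * (r : ℝ) + 1 / s - 3 / 2) (hκ0 : 0 < κ)
    (hd : d = μ₂ - (p⁻¹).toReal + 1 / s) (hlam : κ < μ₁ + 1 / s - 3 / 2) {c₁ : ℝ} (hc₁ : 0 < c₁) :
    ∃ C : ℝ, 0 < C ∧ ∀ (x δ : ℝ) (N : ℕ), 1 ≤ x → δ = x ^ (-d) → c₁ * x ≤ N →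
      minRadius r s μ₁ μ₂ p N δ ≤ ENNReal.ofReal (C * x ^ (-κ)) := by
  obtain ⟨γ, hγ1, hγ2⟩ := exists_between ((one_lt_div hκ0).mpr hlam)
  rw [lt_div_iff₀ hκ0] at hγ2
  obtain ⟨D, hD, hcard⟩ := exists_card_hyperbolicCross_le hr hγ1
  set ε : ℝ := c₁ / D with hε
  have hε0 : 0 < ε := by positivity
  obtain ⟨C, hC, h⟩ := truncError_le_rate (μ₁ := μ₁) hr hs hp hκ hκ0 hd hγ1.le hγ2
    (c₁ := ε / 2) (c₂ := max 1 ε) (by positivity) (by positivity)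
  refine ⟨C, hC, fun x δ N hx hδ hN => ?_⟩
  obtain ⟨h1, h2⟩ := max_one_floor_mul hε0 hx
  refine (minRadius_le_truncError (n := ⌊ε * x⌋₊) hr hγ1.le ?_).trans
    (h x δ _ (by linarith) hδ h1 h2)
  calc _ ≤ D * (⌊ε * x⌋₊ : ℝ) := hcard _
    _ ≤ D * (ε * x) := by
        gcongr
        exact Nat.floor_le (by positivity)
    _ = c₁ * x := by rw [hε]; field_simp
    _ ≤ N := hN

/-- Lower bound for the error of the truncation method. -/
theorem exists_le_truncError (hr : 1 ≤ r) (hs : 1 ≤ s) (p : ℝ≥0∞) (hμ₂ : 0 < μ₂)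
    (hκ : κ = μ₂ - 2 * (r : ℝ) + 1 / s - 3 / 2) (hκ0 : 0 < κ) (hγ : 1 < γ) {c₂ : ℝ}
    (hc₂ : 0 < c₂) :
    ∃ A : ℝ, 0 < A ∧ ∀ (x δ : ℝ) (n : ℕ), 1 ≤ x → 0 ≤ δ → (n : ℝ) ≤ c₂ * x →
      ENNReal.ofReal (A * x ^ (-κ)) ≤ truncError r s μ₁ μ₂ p δ n γ := by
  obtain ⟨D, hD, hcard⟩ := exists_card_hyperbolicCross_le hr hγ
  obtain ⟨c, hc, hlow⟩ := exists_le_minRadius hr (μ₁ := μ₁) hs p hμ₂ hκ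
  refine ⟨c * (D * c₂ + 1) ^ (-κ), by positivity, fun x δ n hx hδ hn => ?_⟩
  have hx0 : 0 < x := by linarith
  set N := ⌊D * c₂ * x⌋₊ + 1 with hN
  have h1 : (N : ℝ) ≤ (D * c₂ + 1) * x := by
    have := Nat.floor_le (show 0 ≤ D * c₂ * x by positivity)
    rw [hN]; push_cast; linarith
  have h2 : ((hyperbolicCross r n γ).card : ℝ) ≤ N := by
    have h3 := Nat.lt_floor_add_one (D * c₂ * x)
    have h4 : D * n ≤ D * (c₂ * x) := by gcongr
    have := hcard n
    rw [hN]; push_cast; linarith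
  refine le_trans (ENNReal.ofReal_le_ofReal ?_) ((hlow δ N hδ (Nat.succ_pos _)).trans
    (minRadius_le_truncError hr hγ.le h2))
  rw [mul_assoc]
  gcongr
  exact le_rpow_neg_of_le_mul (by positivity) hx0 (by positivity) hκ0.le h1

/-- Upper bound for the minimal radius, part b). -/
theorem exists_minRadius_log_le (hr : 1 ≤ r) (hs : 1 ≤ s) {p : ℝ≥0∞} (hp : 1 ≤ p)
    (hκ : κ = μ₂ - 2 * (r : ℝ) + 1 / s - 3 / 2) (hκ0 : 0 < κ)
    (hd : d = μ₂ - (p⁻¹).toReal + 1 / s) (hlam : κ < μ₁ + 1 / s - 3 / 2) {c₁ : ℝ} (hc₁ : 0 < c₁) :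
    ∃ C : ℝ, 0 < C ∧ ∀ (x δ : ℝ) (N : ℕ), 1 ≤ x → δ = x ^ (-d) → 1 ≤ Real.log x →
      c₁ * (x * Real.log x) ≤ N →
      minRadius r s μ₁ μ₂ p N δ ≤ ENNReal.ofReal (C * x ^ (-κ)) := by
  set ε : ℝ := min 1 (c₁ / 3) with hε
  have hε0 : 0 < ε := by positivity
  have hε1 : ε ≤ 1 := min_le_left _ _
  have hε2 : ε ≤ c₁ / 3 := min_le_right _ _
  obtain ⟨C, hC, h⟩ := truncError_le_rate (μ₁ := μ₁) (γ := 1) hr hs hp hκ hκ0 hd le_rfl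
    (by linarith) (c₁ := ε / 2) (c₂ := max 1 ε) (by positivity) (by positivity)
  refine ⟨C, hC, fun x δ N hx hδ hlog hN => ?_⟩
  have hx0 : 0 < x := by linarith
  obtain ⟨h1, h2⟩ := max_one_floor_mul hε0 hx
  refine (minRadius_le_truncError (n := ⌊ε * x⌋₊) hr le_rfl ?_).trans (h x δ _ hx0 hδ h1 h2)
  have hfl := Nat.floor_le (show 0 ≤ ε * x by positivity)
  have hlogn : Real.log (⌊ε * x⌋₊ : ℝ) ≤ Real.log x := by
    rcases Nat.eq_zero_or_pos ⌊ε * x⌋₊ with h0 | h0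
    · rw [h0]; simp; linarith
    · exact Real.log_le_log (by exact_mod_cast h0) (hfl.trans (by nlinarith))
  have hlogn0 : 0 ≤ Real.log (⌊ε * x⌋₊ : ℝ) := Real.log_natCast_nonneg _
  calc _ ≤ (⌊ε * x⌋₊ : ℝ) * (2 + Real.log (⌊ε * x⌋₊ : ℝ)) := card_hyperbolicCross_one_le hr _
    _ ≤ (c₁ / 3 * x) * (3 * Real.log x) := by
        have h3 : ε * x ≤ c₁ / 3 * x := by gcongr
        gcongr
        · exact hfl.trans h3
        · linarith
    _ = c₁ * (x * Real.log x) := by ring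
    _ ≤ N := hN

end Rate

theorem div_log_le {c₁ c₂ x N : ℝ} (hc₂ : 0 < c₂) (hlog : 1 ≤ Real.log x) (hx : 1 ≤ x)
    (hc : 1 ≤ c₁ * Real.log x) (h1 : c₁ * (x * Real.log x) ≤ N) (h2 : N ≤ c₂ * (x * Real.log x)) :
    0 < N / Real.log N ∧ N / Real.log N ≤ c₂ * x := by
  have hxN : x ≤ N := by nlinarith
  have h3 : Real.log x ≤ Real.log N := Real.log_le_log (by linarith) hxN
  have h4 : 0 < Real.log N := by linarith
  refine ⟨div_pos (by linarith) h4, ?_⟩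
  rw [div_le_iff₀ h4]
  have : 0 ≤ c₂ * x := by positivity
  nlinarith

/-- The cardinality of the hyperbolic cross with `γ = 1`. -/
theorem card_hyperbolicCross_one_comparable {r : ℕ} (hr : 1 ≤ r) {c₁ c₂ x : ℝ} (hc₁ : 0 < c₁)
    (hc₂ : 0 < c₂) {n : ℕ} (hx : 1 ≤ x) (hlog : 1 ≤ Real.log x)
    (hlog2 : 2 * |Real.log (c₁ / (2 * r))| ≤ Real.log x) (hn : Comparable c₁ c₂ x n) :
    Comparable (c₁ / 4) (c₂ * (3 + |Real.log c₂|)) (x * Real.log x)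
      ((hyperbolicCross r n 1).card : ℝ) := by
  obtain ⟨h1, h2⟩ := hn
  have hx0 : 0 < x := by linarith
  have hr0 : (0 : ℝ) < r := by exact_mod_cast hr
  have hn0 : (0 : ℝ) < n := lt_of_lt_of_le (by positivity) h1
  constructor
  · have hl : Real.log x / 2 ≤ Real.log (n / (2 * r)) := by
      have h3 : c₁ / (2 * r) * x ≤ n / (2 * r) := by
        rw [div_mul_eq_mul_div]; gcongr
      have h4 := Real.log_le_log (by positivity) h3
      rw [Real.log_mul (by positivity) hx0.ne'] at h4
      have := neg_abs_le (Real.log (c₁ / (2 * r)))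
      linarith
    have h2r : 2 * r ≤ n := by
      have h5 : 0 < Real.log ((n : ℝ) / (2 * r)) := by linarith
      have h6 : 1 < (n : ℝ) / (2 * r) := (Real.log_pos_iff (by positivity)).mp h5
      rw [lt_div_iff₀ (by positivity), one_mul] at h6
      exact_mod_cast h6.le
    calc _ = (c₁ * x) / 2 * (Real.log x / 2) := by ring
      _ ≤ n / 2 * Real.log (n / (2 * r)) := by gcongr
      _ ≤ _ := le_card_hyperbolicCross_one hr h2r
  · refine (card_hyperbolicCross_one_le hr n).trans ?_
    have h3 := Real.log_le_log hn0 h2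
    rw [Real.log_mul hc₂.ne' hx0.ne'] at h3
    have h4 := le_abs_self (Real.log c₂)
    have h5 := abs_nonneg (Real.log c₂)
    have h6 : 2 + Real.log n ≤ (3 + |Real.log c₂|) * Real.log x := by nlinarith
    calc _ ≤ (n : ℝ) * ((3 + |Real.log c₂|) * Real.log x) := by gcongr
      _ ≤ (c₂ * x) * ((3 + |Real.log c₂|) * Real.log x) := by gcongr
      _ = _ := by ring

/-- The substitution `x = δ^{-1/d}`. -/
theorem rpow_neg_one_div_facts {d δ : ℝ} (hd : 0 < d) (hδ : 0 < δ) (hδ1 : δ < 1) (κ : ℝ) :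
    1 ≤ δ ^ (-1 / d) ∧ δ = (δ ^ (-1 / d)) ^ (-d) ∧ δ ^ (κ / d) = (δ ^ (-1 / d)) ^ (-κ) ∧
      Real.log (1 / δ) = d * Real.log (δ ^ (-1 / d)) := by
  refine ⟨Real.one_le_rpow_of_pos_of_le_one_of_nonpos hδ hδ1.le
    (div_nonpos_of_nonpos_of_nonneg (by norm_num) hd.le), ?_, ?_, ?_⟩
  · rw [← Real.rpow_mul hδ.le, show -1 / d * -d = 1 by field_simp, Real.rpow_one]
  · rw [← Real.rpow_mul hδ.le]
    congr 1
    field_simp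
  · rw [Real.log_rpow hδ, one_div, Real.log_inv]
    field_simp

theorem exists_log_threshold {d : ℝ} (hd : 0 < d) {L : ℝ} (hL : 0 < L) :
    ∃ δ₀ : ℝ, 0 < δ₀ ∧ δ₀ < 1 ∧ ∀ δ, 0 < δ → δ ≤ δ₀ → L ≤ Real.log (δ ^ (-1 / d)) := by
  refine ⟨Real.exp (-(d * L)), Real.exp_pos _, Real.exp_lt_one_iff.mpr (by
    have := mul_pos hd hL; linarith), fun δ hδ h => ?_⟩
  have h1 : Real.log δ ≤ -(d * L) := by
    rw [← Real.log_exp (-(d * L))]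
    exact Real.log_le_log hδ h
  rw [Real.log_rpow hδ, div_mul_eq_mul_div, le_div_iff₀ hd]
  linarith

end NumDiff

theorem mainTheorem9 (r : ℕ) (hr : 1 ≤ r) (s μ₁ μ₂ : ℝ) (p : ℝ≥0∞) (hs : 1 ≤ s) (hp : 1 ≤ p)
    (hμ₂ : 2 * (r : ℝ) - 1 / s + 3 / 2 < μ₂) (hμ₁ : μ₂ - 2 * (r : ℝ) < μ₁)
    (κ d : ℝ) (hκ : κ = μ₂ - 2 * (r : ℝ) + 1 / s - 3 / 2)
    (hd : d = μ₂ - (p⁻¹).toReal + 1 / s) :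
    -- the series defining the derivative converges in `C(Q)` on the whole class
    (∀ f ∈ NumDiff.unitClass s μ₁ μ₂, Summable (NumDiff.derivTerm r f)) ∧
    -- part a): two-sided estimates of the minimal radius
    (∀ c₁ c₂ : ℝ, 0 < c₁ → 0 < c₂ → ∃ C₁ C₂ : ℝ, 0 < C₁ ∧ 0 < C₂ ∧
      ∀ δ : ℝ, 0 < δ → δ < 1 → ∀ N : ℕ,
        NumDiff.Comparable c₁ c₂ (δ ^ (-1 / d)) N →
        NumDiff.ComparableE C₁ C₂ ((N : ℝ) ^ (-κ)) (NumDiff.minRadius r s μ₁ μ₂ p N δ) ∧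
        NumDiff.ComparableE C₁ C₂ (δ ^ (κ / d)) (NumDiff.minRadius r s μ₁ μ₂ p N δ) ∧
        NumDiff.Comparable C₁ C₂ (δ ^ (κ / d)) ((N : ℝ) ^ (-κ))) ∧
    -- part a): the truncation method attains them, using a number of coefficients of the same order
    (∀ γ : ℝ, 1 < γ → γ < (μ₁ + 1 / s - 3 / 2) / κ →
      ∀ c₁ c₂ : ℝ, 0 < c₁ → 0 < c₂ → ∃ C₁ C₂ : ℝ, 0 < C₁ ∧ 0 < C₂ ∧
      ∀ δ : ℝ, 0 < δ → δ < 1 → ∀ N n : ℕ,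
        NumDiff.Comparable c₁ c₂ (δ ^ (-1 / d)) N →
        NumDiff.Comparable c₁ c₂ (δ ^ (-1 / d)) n →
        NumDiff.ComparableE C₁ C₂ ((N : ℝ) ^ (-κ)) (NumDiff.truncError r s μ₁ μ₂ p δ n γ) ∧
        NumDiff.ComparableE C₁ C₂ (δ ^ (κ / d)) (NumDiff.truncError r s μ₁ μ₂ p δ n γ) ∧
        ((NumDiff.hyperbolicCross r n γ).card : ℝ) ≤ C₂ * δ ^ (-1 / d) ∧
        (r ≤ n → C₁ * δ ^ (-1 / d) ≤ ((NumDiff.hyperbolicCross r n γ).card : ℝ))) ∧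
    -- part b): estimates of the minimal radius
    (∀ c₁ c₂ : ℝ, 0 < c₁ → 0 < c₂ → ∃ C₁ C₂ δ₀ : ℝ, 0 < C₁ ∧ 0 < C₂ ∧ 0 < δ₀ ∧ δ₀ < 1 ∧
      ∀ δ : ℝ, 0 < δ → δ ≤ δ₀ → ∀ N : ℕ,
        NumDiff.Comparable c₁ c₂ (δ ^ (-1 / d) * Real.log (1 / δ)) N →
        ENNReal.ofReal (C₁ * (N : ℝ) ^ (-κ)) ≤ NumDiff.minRadius r s μ₁ μ₂ p N δ ∧
        NumDiff.minRadius r s μ₁ μ₂ p N δ ≤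
          ENNReal.ofReal (C₂ * ((N : ℝ) / Real.log N) ^ (-κ)) ∧
        ENNReal.ofReal (C₁ * (δ ^ (κ / d) * Real.log (1 / δ) ^ (-κ))) ≤
          NumDiff.minRadius r s μ₁ μ₂ p N δ ∧
        NumDiff.minRadius r s μ₁ μ₂ p N δ ≤ ENNReal.ofReal (C₂ * δ ^ (κ / d))) ∧
    -- part b): the truncation method with `γ = 1` attains the upper bounds, using a number of
    -- coefficients of the same order
    (∀ c₁ c₂ : ℝ, 0 < c₁ → 0 < c₂ → ∃ C₁ C₂ δ₀ : ℝ, 0 < C₁ ∧ 0 < C₂ ∧ 0 < δ₀ ∧ δ₀ < 1 ∧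
      ∀ δ : ℝ, 0 < δ → δ ≤ δ₀ → ∀ N n : ℕ,
        NumDiff.Comparable c₁ c₂ (δ ^ (-1 / d) * Real.log (1 / δ)) N →
        NumDiff.Comparable c₁ c₂ (δ ^ (-1 / d)) n →
        NumDiff.truncError r s μ₁ μ₂ p δ n 1 ≤
          ENNReal.ofReal (C₂ * ((N : ℝ) / Real.log N) ^ (-κ)) ∧
        NumDiff.truncError r s μ₁ μ₂ p δ n 1 ≤ ENNReal.ofReal (C₂ * δ ^ (κ / d)) ∧
        NumDiff.Comparable C₁ C₂ (δ ^ (-1 / d) * Real.log (1 / δ))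
          ((NumDiff.hyperbolicCross r n 1).card : ℝ)) := by
  have hs0 : 0 < 1 / s := by positivity
  have hr' : (1 : ℝ) ≤ r := by exact_mod_cast hr
  have hs1 : 1 / s ≤ 1 := (div_le_one (by linarith)).mpr hs
  have hκ0 : 0 < κ := by linarith
  have hμ0 : 0 < μ₂ := by linarith
  have hlam : κ < μ₁ + 1 / s - 3 / 2 := by linarith
  have hp1 : (p⁻¹).toReal ≤ 1 := by
    rw [← ENNReal.toReal_one]
    exact ENNReal.toReal_mono ENNReal.one_ne_top (ENNReal.inv_le_one.mpr hp)
  have hd0 : 0 < d := by linarith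
  obtain ⟨c, hc, hlow⟩ := NumDiff.exists_le_minRadius hr (μ₁ := μ₁) hs p hμ0 hκ
  refine ⟨fun f hf => (NumDiff.summable_norm_derivTerm hr hs hκ hκ0 hlam hf).of_norm,
    ?_, ?_, ?_, ?_⟩
  · intro c₁ c₂ hc₁ hc₂
    obtain ⟨B, hB, hup⟩ := NumDiff.exists_minRadius_le (μ₁ := μ₁) hr hs hp hκ hκ0 hd hlam hc₁
    obtain ⟨C₁, C₂, hC₁, hC₂, _, _, hcomp⟩ := NumDiff.comparable_of_two_sided (e₁ := 1) (e₂ := 1)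
      (A := c * c₂ ^ (-κ)) hc₁ hc₂ (by positivity) hB one_pos hκ0.le
    refine ⟨C₁, C₂, hC₁, hC₂, fun δ hδ hδ1 N hN => ?_⟩
    obtain ⟨hx1, hδx, hκx, -⟩ := NumDiff.rpow_neg_one_div_facts hd0 hδ hδ1 κ
    rw [hκx]
    set x := δ ^ (-1 / d)
    have hx0 : 0 < x := by linarith
    have hN0 : (0 : ℝ) < N := lt_of_lt_of_le (by positivity) hN.1
    refine hcomp x N _ hx0 hN ?_ (hup x δ N hx1 hδx hN.1)
    refine le_trans (ENNReal.ofReal_le_ofReal ?_) (hlow δ N hδ.le (by exact_mod_cast hN0))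
    rw [mul_assoc]
    gcongr
    exact NumDiff.le_rpow_neg_of_le_mul hc₂ hx0 hN0 hκ0.le hN.2
  · intro γ hγ1 hγ2 c₁ c₂ hc₁ hc₂
    rw [lt_div_iff₀ hκ0] at hγ2
    obtain ⟨B, hB, hup⟩ := NumDiff.truncError_le_rate (μ₁ := μ₁) hr hs hp hκ hκ0 hd hγ1.le hγ2
      hc₁ hc₂
    obtain ⟨A, hA, hlow'⟩ := NumDiff.exists_le_truncError (μ₁ := μ₁) hr hs p hμ0 hκ hκ0 hγ1 hc₂
    obtain ⟨D, hD, hcard⟩ := NumDiff.exists_card_hyperbolicCross_le hr hγ1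
    obtain ⟨C₁, C₂, hC₁, hC₂, he₁, he₂, hcomp⟩ := NumDiff.comparable_of_two_sided (e₁ := c₁ / r)
      (e₂ := D * c₂) hc₁ hc₂ hA hB (by positivity) hκ0.le
    refine ⟨C₁, C₂, hC₁, hC₂, fun δ hδ hδ1 N n hN hn => ?_⟩
    obtain ⟨hx1, hδx, hκx, -⟩ := NumDiff.rpow_neg_one_div_facts hd0 hδ hδ1 κ
    rw [hκx]
    set x := δ ^ (-1 / d)
    have hx0 : 0 < x := by linarith
    have hn0 : (0 : ℝ) < n := lt_of_lt_of_le (by positivity) hn.1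
    have hmax : ((max 1 n : ℕ) : ℝ) = n := by
      rw [max_eq_right (by exact_mod_cast hn0)]
    obtain ⟨h1, h2, -⟩ := hcomp x N _ hx0 hN (hlow' x δ n hx1 hδ.le hn.2)
      (hup x δ n hx0 hδx (by rw [hmax]; exact hn.1) (by rw [hmax]; exact hn.2))
    refine ⟨h1, h2, ?_, fun hrn => ?_⟩
    · calc _ ≤ D * (n : ℝ) := hcard n
        _ ≤ D * (c₂ * x) := by
          gcongr
          exact hn.2
        _ = D * c₂ * x := by ring
        _ ≤ _ := by gcongr
    · calc _ ≤ c₁ / r * x := by gcongr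
        _ = (c₁ * x) / r := by ring
        _ ≤ n / r := by
          gcongr
          exact hn.1
        _ ≤ _ := NumDiff.le_card_hyperbolicCross hr hrn hγ1.le
  · intro c₁ c₂ hc₁ hc₂
    obtain ⟨B, hB, hup⟩ := NumDiff.exists_minRadius_log_le (μ₁ := μ₁) hr hs hp hκ hκ0 hd hlam
      (mul_pos hc₁ hd0)
    obtain ⟨δ₀, hδ₀, hδ₀1, hthr⟩ := NumDiff.exists_log_threshold hd0
      (L := max 1 (1 / (c₁ * d))) (by positivity)
    refine ⟨min c (c * c₂ ^ (-κ)), max B (B * (c₂ * d) ^ κ), δ₀, by positivity, by positivity, hδ₀,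
      hδ₀1, fun δ hδ hδδ₀ N hN => ?_⟩
    have hL := hthr δ hδ hδδ₀
    obtain ⟨hx1, hδx, hκx, hlog⟩ := NumDiff.rpow_neg_one_div_facts hd0 hδ (hδδ₀.trans_lt hδ₀1) κ
    obtain ⟨hN1, hN2⟩ := hN
    rw [hκx]
    set x := δ ^ (-1 / d)
    set l := Real.log (1 / δ) with hl
    have hx0 : 0 < x := by linarith
    have hL1 : 1 ≤ Real.log x := (le_max_left _ _).trans hL
    have hL2 : 1 ≤ c₁ * d * Real.log x := by
      have := (le_max_right _ _).trans hL
      rwa [div_le_iff₀' (by positivity)] at this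
    have hl0 : 0 < l := by rw [hlog]; positivity
    have hN0 : (0 : ℝ) < N := lt_of_lt_of_le (by positivity) hN1
    have hN1' : c₁ * d * (x * Real.log x) ≤ N := by
      refine le_trans (le_of_eq ?_) hN1; rw [hlog]; ring
    have hN2' : (N : ℝ) ≤ c₂ * d * (x * Real.log x) := by
      refine hN2.trans (le_of_eq ?_); rw [hlog]; ring
    obtain ⟨hq0, hq⟩ := NumDiff.div_log_le (by positivity) hL1 hx1 hL2 hN1' hN2'
    have hlowN := hlow δ N hδ.le (by exact_mod_cast hN0)
    have hupN := hup x δ N hx1 hδx hL1 hN1'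
    refine ⟨le_trans (ENNReal.ofReal_le_ofReal ?_) hlowN,
      hupN.trans (ENNReal.ofReal_le_ofReal ?_), le_trans (ENNReal.ofReal_le_ofReal ?_) hlowN,
      hupN.trans (ENNReal.ofReal_le_ofReal ?_)⟩
    · gcongr
      exact min_le_left _ _
    · calc _ ≤ B * ((c₂ * d) ^ κ * ((N : ℝ) / Real.log N) ^ (-κ)) := by
            gcongr
            exact NumDiff.rpow_neg_le_of_le_mul (by positivity) hx0 hq0 hκ0.le hq
        _ = B * (c₂ * d) ^ κ * ((N : ℝ) / Real.log N) ^ (-κ) := by ring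
        _ ≤ _ := by
            have := hq0.le
            gcongr
            exact le_max_right _ _
    · rw [← Real.mul_rpow hx0.le hl0.le]
      calc _ ≤ c * c₂ ^ (-κ) * (x * l) ^ (-κ) := by
            gcongr
            exact min_le_right _ _
        _ = c * (c₂ ^ (-κ) * (x * l) ^ (-κ)) := by ring
        _ ≤ _ := by
            gcongr
            exact NumDiff.le_rpow_neg_of_le_mul hc₂ (by positivity) hN0 hκ0.le hN2
    · gcongr
      exact le_max_left _ _
  · intro c₁ c₂ hc₁ hc₂
    obtain ⟨B, hB, hup⟩ := NumDiff.truncError_le_rate (μ₁ := μ₁) (γ := 1) hr hs hp hκ hκ0 hd le_rfl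
      (by linarith) hc₁ hc₂
    obtain ⟨δ₀, hδ₀, hδ₀1, hthr⟩ := NumDiff.exists_log_threshold hd0
      (L := max (max 1 (1 / (c₁ * d))) (2 * |Real.log (c₁ / (2 * r))|)) (by positivity)
    refine ⟨c₁ / 4 / d, max (max B (B * (c₂ * d) ^ κ)) (c₂ * (3 + |Real.log c₂|) / d), δ₀,
      by positivity, by positivity, hδ₀, hδ₀1, fun δ hδ hδδ₀ N n hN hn => ?_⟩
    have hL := hthr δ hδ hδδ₀
    obtain ⟨hx1, hδx, hκx, hlog⟩ := NumDiff.rpow_neg_one_div_facts hd0 hδ (hδδ₀.trans_lt hδ₀1) κ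
    obtain ⟨hN1, hN2⟩ := hN
    rw [hκx]
    set x := δ ^ (-1 / d)
    set l := Real.log (1 / δ) with hl
    have hx0 : 0 < x := by linarith
    have hL1 : 1 ≤ Real.log x := (le_max_left _ _).trans ((le_max_left _ _).trans hL)
    have hL2 : 1 ≤ c₁ * d * Real.log x := by
      have := (le_max_right _ _).trans ((le_max_left _ _).trans hL)
      rwa [div_le_iff₀' (by positivity)] at this
    have hN1' : c₁ * d * (x * Real.log x) ≤ N := by
      refine le_trans (le_of_eq ?_) hN1; rw [hlog]; ring
    have hN2' : (N : ℝ) ≤ c₂ * d * (x * Real.log x) := by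
      refine hN2.trans (le_of_eq ?_); rw [hlog]; ring
    obtain ⟨hq0, hq⟩ := NumDiff.div_log_le (by positivity) hL1 hx1 hL2 hN1' hN2'
    have hn0 : (0 : ℝ) < n := lt_of_lt_of_le (by positivity) hn.1
    have hmax : ((max 1 n : ℕ) : ℝ) = n := by
      rw [max_eq_right (by exact_mod_cast hn0)]
    have hupN := hup x δ n hx0 hδx (by rw [hmax]; exact hn.1) (by rw [hmax]; exact hn.2)
    obtain ⟨hc1, hc2⟩ := NumDiff.card_hyperbolicCross_one_comparable hr hc₁ hc₂ hx1 hL1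
      ((le_max_right _ _).trans hL) hn
    have hxl : x * Real.log x = x * l / d := by rw [hlog]; field_simp
    have hl0 : 0 < l := by rw [hlog]; positivity
    rw [hxl] at hc1 hc2
    refine ⟨hupN.trans (ENNReal.ofReal_le_ofReal ?_), hupN.trans (ENNReal.ofReal_le_ofReal ?_),
      le_trans (le_of_eq ?_) hc1, hc2.trans ?_⟩
    · calc _ ≤ B * ((c₂ * d) ^ κ * ((N : ℝ) / Real.log N) ^ (-κ)) := by
            gcongr
            exact NumDiff.rpow_neg_le_of_le_mul (by positivity) hx0 hq0 hκ0.le hq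
        _ = B * (c₂ * d) ^ κ * ((N : ℝ) / Real.log N) ^ (-κ) := by ring
        _ ≤ _ := by
            have := hq0.le
            gcongr
            exact le_max_of_le_left (le_max_right _ _)
    · gcongr
      exact le_max_of_le_left (le_max_left _ _)
    · ring
    · calc _ = c₂ * (3 + |Real.log c₂|) / d * (x * l) := by ring
        _ ≤ _ := by
            gcongr
            exact le_max_right _ _
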